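/- Let $d,d_1\ge 1$ be integers and $\gamma\in\mathbb R$. Let $H^{s}_2=H^{s}_2(\mathbb R^d;\mathbb R^{d_1})$ be the space of $\mathbb R^{d_1}$-valued distributions $v$ on $\mathbb R^d$ with $(1-\Delta)^{s/2}v\in L_2$, with norm $\|v\|_{H^s_2}=\big(\sum_{k}\|(1-\Delta)^{s/2}v^k\|_{L_2}^2\big)^{1/2}$. For $T\in(0,\infty)$ let $\mathbb H^s_2(T)=L_2((0,T],H^s_2)$, with norm $\|u\|_{\mathbb H^s_2(T)}=\big(\int_0^T\|u(t)\|_{H^s_2}^2dt\big)^{1/2}$. For a distribution-valued function $u$ on $[0,T]$ and $g\in\mathbb H^\gamma_2(T)$, we say that $u_t=g$ in the sense of distributions if for every $\phi\in C_0^\infty(\mathbb R^d)$, every $k$ and every $t\in[0,T]$, $$(u^k(t),\phi)=(u^k(0),\phi)+\int_0^t(g^k(s),\phi)\,ds .$$ Let $\mathcal H^{\gamma+2}_2(T)$ be the set of distribution-valued functions $u$ on $[0,T]$ such that $u\in\mathbb H^{\gamma+2}_2(T)$, $u(0)\in H^{\gamma+1}_2$ and $u_t=g$ in the sense of distributions for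 some $g\in\mathbb H^\gamma_2(T)$. **Theorem.** Let $\delta,K^1,\dots,K^d>0$. There is a constant $c>0$, depending only on $d,d_1,\gamma,\delta,K^1,\dots,K^d$, such that the following holds for every $T\in(0,\infty)$. Let $A^{ij}(t)=(a^{ij}_{kr}(t))_{k,r=1}^{d_1}$, $i,j=1,\dots,d$, be real matrices depending only on $t\in(0,T]$, measurable and bounded in $t$, such that for all $t\in(0,T]$ $$\delta|\xi|^2\le \sum_{i,j}\xi_i^*A^{ij}(t)\xi_j\quad\text{for every real } d_1\times d \text{ matrix } \xi \text{ with columns } \xi_1,\dots,\xi_d,$$ $$|A^{1j}(t)|\le K^j,\quad j=1,\dots,d,$$ where $|C|=(\sum_{k,r}c_{kr}^2)^{1/2}$ for a matrix $C=(c_{kr})$. Then for every $f\in\mathbb H^\gamma_2(T)$ and $u_0\in H^{\gamma+1}_2$ the system $$u^k_t=\sum_{i,j=1}^{d}\sum_{r=1}^{d_1}a^{ij}_{kr}(t)\,u^r_{x^ix^j}+f^k,\qquad u^k(0)=u^k_0,\qquad k=1,\dots,d_1,$$ understood in the sense of distributions, has a unique solution $u\in\mathcal H^{\gamma+2}_2(T)$,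 and for this solution $u_{xx}=(u_{x^ix^j})_{i,j}$ has all its entries in $\mathbb H^\gamma_2(T)$ and $$\|u_{xx}\|_{\mathbb H^\gamma_2(T)}\le c\|f\|_{\mathbb H^\gamma_2(T)}+c\|u_0\|_{H^{\gamma+1}_2},$$ $$\|u\|_{\mathbb H^{\gamma+2}_2(T)}\le c\,e^{cT}\big(\|f\|_{\mathbb H^\gamma_2(T)}+\|u_0\|_{H^{\gamma+1}_2}\big),$$ where $\|u_{xx}\|_{\mathbb H^\gamma_2(T)}=\big(\sum_{i,j}\|u_{x^ix^j}\|^2_{\mathbb H^\gamma_2(T)}\big)^{1/2}$. -/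

import Mathlib

open MeasureTheory Set
open scoped SchwartzMap LineDeriv Laplacian FourierTransform

namespace ParabolicSystem

noncomputable section

/-- The space `ℝ^d` with its Euclidean norm. -/
abbrev Space (d : ℕ) : Type := EuclideanSpace ℝ (Fin d)

/-- Tuples `(u^1, …, u^{d₁})` of tempered distributions on `ℝ^d`. Mathlib's tempered distributions
are complex; the real-valued ones are singled out by `IsRealDistribution`. Every element of a
Bessel potential space is a tempered distribution, so nothing is lost by working in `𝓢'`. -/
abbrev VecDistribution (d d₁ : ℕ) : Type := Fin d₁ → 𝓢'(Space d, ℂ)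

/-- A distribution is real-valued if it takes real values on real-valued test functions. -/
def IsRealDistribution {d : ℕ} (v : 𝓢'(Space d, ℂ)) : Prop :=
  ∀ φ : 𝓢(Space d, ℂ), (∀ x, (φ x).im = 0) → (v φ).im = 0

/-- The symbol `(1 + |2πξ|²)^{s/2}` of `(1 - Δ)^{s/2}`, for the Fourier transform with kernel
`exp (-2πi x·ξ)` that Mathlib uses. -/
def besselSymbol (d : ℕ) (s : ℝ) (ξ : Space d) : ℝ :=
  (1 + (2 * Real.pi * ‖ξ‖) ^ 2) ^ (s / 2)

/-- The operator `(1 - Δ)^{s/2}` on tempered distributions. -/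
def bessel {d : ℕ} (s : ℝ) : 𝓢'(Space d, ℂ) →L[ℂ] 𝓢'(Space d, ℂ) :=
  TemperedDistribution.fourierMultiplierCLM ℂ (fun ξ ↦ (besselSymbol d s ξ : ℂ))

theorem besselSymbol_hasTemperateGrowth (d : ℕ) (s : ℝ) :
    (fun ξ : Space d ↦ (besselSymbol d s ξ : ℂ)).HasTemperateGrowth := by
  have h := (Function.hasTemperateGrowth_one_add_norm_sq_rpow (Space d) (s / 2)).comp
    (((2 * Real.pi) • ContinuousLinearMap.id ℝ (Space d)).hasTemperateGrowth)
  have h2 : (fun ξ : Space d ↦ besselSymbol d s ξ).HasTemperateGrowth := by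
    have e : (fun ξ : Space d ↦ besselSymbol d s ξ) =
        (fun x : Space d ↦ (1 + ‖x‖ ^ 2) ^ (s / 2)) ∘
          ((2 * Real.pi) • ContinuousLinearMap.id ℝ (Space d)) := by
      funext ξ
      simp [besselSymbol, norm_smul, abs_of_pos Real.pi_pos]
    rwa [e]
  fun_prop

/-- The scalar space `H^s_2(ℝ^d)`, complex-valued: `(1 - Δ)^{s/2} v` is an `L²` function. -/
def MemScalarH {d : ℕ} (s : ℝ) (v : 𝓢'(Space d, ℂ)) : Prop :=
  ∃ g : Lp ℂ 2 (volume : Measure (Space d)), bessel s v = (g : 𝓢'(Space d, ℂ))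

open Classical in
/-- The `L²` function `(1 - Δ)^{s/2} v` for `v ∈ H^s_2` (and `0` otherwise). It is unique since
`L²` embeds in the tempered distributions. -/
def besselRep {d : ℕ} (s : ℝ) (v : 𝓢'(Space d, ℂ)) : Lp ℂ 2 (volume : Measure (Space d)) :=
  if h : MemScalarH s v then h.choose else 0

/-- The Bessel potential space `H^s_2 = H^s_2(ℝ^d; ℝ^{d₁})`. -/
def MemH {d d₁ : ℕ} (s : ℝ) (v : VecDistribution d d₁) : Prop :=
  ∀ k, IsRealDistribution (v k) ∧ MemScalarH s (v k)

/-- The norm `‖v‖_{H^s_2} = (∑_k ‖(1 - Δ)^{s/2} v^k‖²_{L²})^{1/2}`, meant for `v ∈ H^s_2`. -/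
def hNorm {d d₁ : ℕ} (s : ℝ) (v : VecDistribution d d₁) : ℝ :=
  √(∑ k, ‖besselRep s (v k)‖ ^ 2)

/-- The space `ℍ^s_2(T) = L₂((0,T], H^s_2)`: Bochner measurability and square integrability are
those of the functions `t ↦ (1 - Δ)^{s/2} u^k(t)` with values in `L²`. -/
def MemBH {d d₁ : ℕ} (s T : ℝ) (u : ℝ → VecDistribution d d₁) : Prop :=
  (∀ᵐ t ∂(volume.restrict (Ioc 0 T)), MemH s (u t)) ∧
    ∀ k, MemLp (fun t ↦ besselRep s (u t k)) 2 (volume.restrict (Ioc 0 T))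

/-- The norm `‖u‖_{ℍ^s_2(T)} = (∫_0^T ‖u(t)‖²_{H^s_2} dt)^{1/2}`, meant for `u ∈ ℍ^s_2(T)`. -/
def bhNorm {d d₁ : ℕ} (s T : ℝ) (u : ℝ → VecDistribution d d₁) : ℝ :=
  √(∫ t in Ioc 0 T, hNorm s (u t) ^ 2)

/-- `u_t = g` in the sense of distributions on `[0,T]`, with `g ∈ ℍ^s_2(T)`:
`(u^k(t), φ) = (u^k(0), φ) + ∫_0^t (g^k(s), φ) ds` for all smooth compactly supported `φ`,
all components `k` and all `t ∈ [0,T]`. (Testing with complex-valued `φ` amounts to testing with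
the real and imaginary parts.) -/
def HasTimeDeriv {d d₁ : ℕ} (s T : ℝ) (u g : ℝ → VecDistribution d d₁) : Prop :=
  MemBH s T g ∧
    ∀ φ : 𝓢(Space d, ℂ), HasCompactSupport φ → ∀ k, ∀ t ∈ Icc 0 T,
      u t k φ = u 0 k φ + ∫ τ in (0 : ℝ)..t, g τ k φ

/-- The space `𝓗^{γ+2}_2(T)`: `u ∈ ℍ^{γ+2}_2(T)`, `u(0) ∈ U^{γ+2}_2 = H^{γ+1}_2` and `u_t = g` in
the sense of distributions for some `g ∈ ℍ^γ_2(T)`. -/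
def MemSolutionSpace {d d₁ : ℕ} (γ T : ℝ) (u : ℝ → VecDistribution d d₁) : Prop :=
  MemBH (γ + 2) T u ∧ MemH (γ + 1) (u 0) ∧ ∃ g, HasTimeDeriv γ T u g

/-- The second derivative `u_{x^i x^j}`, taken componentwise in the sense of distributions. -/
def secondDeriv {d d₁ : ℕ} (i j : Fin d) (v : VecDistribution d d₁) : VecDistribution d d₁ :=
  fun k ↦ ∂_{(EuclideanSpace.single i (1 : ℝ) : Space d)}
    (∂_{(EuclideanSpace.single j (1 : ℝ) : Space d)} (v k))

/-- `‖u_{xx}‖_{ℍ^s_2(T)} = (∑_{i,j} ‖u_{x^i x^j}‖²_{ℍ^s_2(T)})^{1/2}`. -/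
def bhNormHessian {d d₁ : ℕ} (s T : ℝ) (u : ℝ → VecDistribution d d₁) : ℝ :=
  √(∑ i, ∑ j, bhNorm s T (fun t ↦ secondDeriv i j (u t)) ^ 2)

/-- Coefficients `a^{ij}_{kr}(t) = a t i j k r` that depend on time only; `a t i j` is the
`d₁ × d₁` matrix `A^{ij}(t)`. -/
abbrev Coeff (d d₁ : ℕ) : Type := ℝ → Fin d → Fin d → Matrix (Fin d₁) (Fin d₁) ℝ

/-- The norm `|C| = (∑_{k,r} c_{kr}²)^{1/2}` of a matrix. -/
def matNorm {d₁ : ℕ} (C : Matrix (Fin d₁) (Fin d₁) ℝ) : ℝ :=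
  √(∑ k, ∑ r, C k r ^ 2)

/-- `δ |ξ|² ≤ ξ_i^* A^{ij}(t) ξ_j` for all `t ∈ (0,T]` and all real `d₁ × d` matrices `ξ` with
columns `ξ_i`. -/
def Elliptic {d d₁ : ℕ} (δ T : ℝ) (a : Coeff d d₁) : Prop :=
  ∀ t ∈ Ioc 0 T, ∀ ξ : Matrix (Fin d₁) (Fin d) ℝ,
    δ * ∑ k, ∑ i, ξ k i ^ 2 ≤ ∑ i, ∑ j, ∑ k, ∑ r, ξ k i * a t i j k r * ξ r j

/-- The right-hand side `a^{ij}_{kr} u^r_{x^i x^j} + f^k` of the system. -/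
def systemRHS {d d₁ : ℕ} (a : Coeff d d₁) (f u : ℝ → VecDistribution d d₁) :
    ℝ → VecDistribution d d₁ :=
  fun t k ↦ (∑ i, ∑ j, ∑ r, (a t i j k r : ℂ) • secondDeriv i j (u t) r) + f t k

/-- `u ∈ 𝓗^{γ+2}_2(T)` solves `u^k_t = a^{ij}_{kr} u^r_{x^i x^j} + f^k`, `u^k(0) = u^k_0`. -/
def IsSolution {d d₁ : ℕ} (γ T : ℝ) (a : Coeff d d₁) (f : ℝ → VecDistribution d d₁)
    (u₀ : VecDistribution d d₁) (u : ℝ → VecDistribution d d₁) : Prop :=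
  MemSolutionSpace γ T u ∧ u 0 = u₀ ∧ HasTimeDeriv γ T u (systemRHS a f u)

end

end ParabolicSystem

namespace ParabolicSystem

open Filter Topology
open scoped ContDiff ENNReal

noncomputable section

/-! Because the coefficients depend on time only, the Fourier transform turns the system into a
family of ordinary differential equations indexed by frequency. An element `v` of `H^s_2` is
represented by the `L²` function `h`, the Fourier transform of `(1-Δ)^{s/2} v`; `freqDist s` is the
inverse map. Changing the Sobolev index multiplies `h` by a power of `1 + |2πξ|²`. With `U`, `F`,
`U₀` representing `u`, `f`, `u₀` at levels `γ+2`, `γ`, `γ+1`, and `J` the multiplier of `(1-Δ)⁻¹`,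
the system reads `J U(t) = J^{1/2} U₀ + ∫₀ᵗ (A(τ) U + F) dτ`, where `A(t) = coefOp (a t)` is bounded
on `L²`. The right-hand side, `trajectory`, is defined at every time, whereas `U` matters only
almost everywhere.

Ellipticity applied to rank-one matrices gives, at each frequency and hence for every nonnegative
multiplier `w`, the bound `Re⟨A U, w U⟩ ≤ -δ Re⟨R U, w U⟩`, with `R` the multiplier of `-Δ(1-Δ)⁻¹`
(`EllipticAt.re_inner_coefOp_le`). Two weights suffice. Taking `w = J` in the energy identity bounds
the trajectory by the data, hence gives uniqueness (`IsMild.norm_trajectory_sq_le`). Taking `w = R`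
bounds `∫ ‖R U‖²`, that is, the second derivatives, with constants depending on `δ` alone
(`IsMild.integral_lap_sq_le`). Since `U = R U + J U`, the two together control `U`, with at most
polynomial growth in `T`, which `e^{cT}` absorbs.

For existence, data cut off at frequency `n` lead to a linear differential equation with bounded
operators, solved by contraction. The a priori bound applied to differences makes these solutions
Cauchy, and the limit keeps the estimates (`Admissible.exists_isMild`). Real data give real
solutions because conjugate reflection in frequency commutes with the equation and the trajectory is
unique. Conversely, a weak solution satisfies the integrated equation because compactly supported
test functions determine a tempered distribution. -/

/-! ### Vector-valued calculus in time: energy identity and linear differential equations -/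

/-- A function whose increments are dominated by those of an absolutely continuous function is
absolutely continuous. -/
theorem absolutelyContinuousOnInterval_of_dist_le {X Y : Type*} [PseudoMetricSpace X]
    [PseudoMetricSpace Y] {f : ℝ → X} {g : ℝ → Y} {a b C : ℝ}
    (hg : AbsolutelyContinuousOnInterval g a b)
    (h : ∀ s ∈ uIcc a b, ∀ t ∈ uIcc a b, dist (f s) (f t) ≤ C * dist (g s) (g t)) :
    AbsolutelyContinuousOnInterval f a b := by
  rw [absolutelyContinuousOnInterval_iff] at hg ⊢
  intro ε hε
  obtain ⟨δ, hδ, H⟩ := hg (ε / (|C| + 1)) (by positivity)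
  refine ⟨δ, hδ, fun E hE hlt ↦ ?_⟩
  have h1 := H E hE hlt
  rw [lt_div_iff₀ (by positivity)] at h1
  refine lt_of_le_of_lt ?_ h1
  rw [Finset.sum_mul]
  refine Finset.sum_le_sum fun i hi ↦ ?_
  have hm := (hE.1 i hi)
  refine (h _ hm.1 _ hm.2).trans ?_
  nlinarith [le_abs_self C, dist_nonneg (x := g (E.2 i).1) (y := g (E.2 i).2)]

theorem continuousOn_intervalIntegral {X : Type*} [NormedAddCommGroup X] [NormedSpace ℝ X]
    {T : ℝ} (hT : 0 ≤ T) {h : ℝ → X} (hh : IntervalIntegrable h volume 0 T) :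
    ContinuousOn (fun t ↦ ∫ τ in (0 : ℝ)..t, h τ) (Icc 0 T) := by
  rw [← uIcc_of_le hT]
  refine intervalIntegral.continuousOn_primitive_interval ?_
  rw [uIcc_of_le hT, integrableOn_Icc_iff_integrableOn_Ioc]
  exact (intervalIntegrable_iff_integrableOn_Ioc_of_le hT).1 hh

/-- The energy identity for a Hilbert space valued primitive. -/
theorem norm_sq_primitive_eq {X : Type*} [NormedAddCommGroup X] [InnerProductSpace ℂ X]
    [NormedSpace ℝ X] [CompleteSpace X] {T : ℝ} {h y : ℝ → X} {y₀ : X}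
    (hh : IntervalIntegrable h volume 0 T)
    (hy : ∀ t ∈ Icc 0 T, y t = y₀ + ∫ τ in (0 : ℝ)..t, h τ) {t : ℝ} (ht : t ∈ Icc 0 T) :
    ‖y t‖ ^ 2 = ‖y₀‖ ^ 2 + 2 * ∫ τ in (0 : ℝ)..t, (inner ℂ (y τ) (h τ)).re := by
  set z : ℝ → X := fun t ↦ y₀ + ∫ τ in (0 : ℝ)..t, h τ with hz
  have hT : (0 : ℝ) ≤ t := ht.1
  have hht : IntervalIntegrable h volume 0 t :=
    hh.mono_set (by rw [uIcc_of_le hT, uIcc_of_le (hT.trans ht.2)]; exact Icc_subset_Icc_right ht.2)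
  have hzc : ContinuousOn z (Icc 0 t) :=
    continuousOn_const.add (continuousOn_intervalIntegral hT hht)
  obtain ⟨C, hC⟩ := isCompact_Icc.exists_bound_of_continuousOn hzc
  have hg := hht.norm.absolutelyContinuousOnInterval_intervalIntegral (c := 0) (by simp)
  -- The scalar primitive of `‖h‖` dominates the increments of `z`, and, as `z` is bounded on the
  -- interval, those of `‖z‖²` too. This makes `‖z‖²` absolutely continuous, so it is recovered from
  -- its a.e. derivative.
  have hdist : ∀ r ∈ uIcc 0 t, ∀ s ∈ uIcc 0 t,
      dist (z r) (z s) ≤ dist (∫ τ in (0 : ℝ)..r, ‖h τ‖) (∫ τ in (0 : ℝ)..s, ‖h τ‖) := by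
    intro r hr s hs
    have hr' : IntervalIntegrable h volume 0 r :=
      hht.mono_set (uIcc_subset_uIcc_left hr)
    have hs' : IntervalIntegrable h volume 0 s :=
      hht.mono_set (uIcc_subset_uIcc_left hs)
    rw [hz, dist_add_left, dist_eq_norm, dist_eq_norm,
      intervalIntegral.integral_interval_sub_left hr' hs',
      intervalIntegral.integral_interval_sub_left hr'.norm hs'.norm]
    exact intervalIntegral.norm_integral_le_abs_integral_norm
  have hac : AbsolutelyContinuousOnInterval (fun t ↦ ‖z t‖ ^ 2) 0 t := by
    refine absolutelyContinuousOnInterval_of_dist_le (C := 2 * C) hg fun r hr s hs ↦ ?_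
    have h1 := hdist r hr s hs
    rw [uIcc_of_le hT] at hr hs
    have hr1 := hC r hr
    have hs1 := hC s hs
    have h2 : dist (‖z r‖ ^ 2) (‖z s‖ ^ 2) = |‖z r‖ - ‖z s‖| * (‖z r‖ + ‖z s‖) := by
      rw [Real.dist_eq, ← abs_of_nonneg (add_nonneg (norm_nonneg (z r)) (norm_nonneg (z s))),
        ← abs_mul]
      congr 1; ring
    rw [h2]
    have h3 := abs_norm_sub_norm_le (z r) (z s)
    rw [← dist_eq_norm] at h3
    calc _ ≤ dist (z r) (z s) * (C + C) := by gcongr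
      _ ≤ _ := by
        have : 0 ≤ C := (norm_nonneg _).trans hr1
        nlinarith
  have h4 := hac.integral_deriv_eq_sub
  have h5 : ∫ τ in (0 : ℝ)..t, deriv (fun t ↦ ‖z t‖ ^ 2) τ =
      ∫ τ in (0 : ℝ)..t, 2 * (inner ℂ (y τ) (h τ)).re := by
    refine intervalIntegral.integral_congr_ae ?_
    filter_upwards [hht.ae_hasDerivAt_integral] with τ hτ hτ'
    have hτ1 := uIoc_subset_uIcc hτ'
    have h6 : HasDerivAt z (h τ) τ := (hτ hτ1 0 (by simp)).const_add y₀
    have h7 := (Complex.reCLM.hasFDerivAt.comp_hasDerivAt τ (h6.inner ℂ h6))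
    have h8 : (fun t ↦ ‖z t‖ ^ 2) = Complex.reCLM ∘ fun t ↦ inner ℂ (z t) (z t) := by
      funext t
      simp only [Function.comp, Complex.reCLM_apply]
      exact (inner_self_eq_norm_sq (𝕜 := ℂ) (z t)).symm
    rw [h8, h7.deriv]
    rw [uIcc_of_le hT] at hτ1
    rw [hy τ ⟨hτ1.1, hτ1.2.trans ht.2⟩]
    simp only [Complex.reCLM_apply, Complex.add_re]
    have := inner_re_symm (𝕜 := ℂ) (h τ) (z τ)
    simp only [RCLike.re_to_complex] at this
    rw [this]
    simp only [hz]
    ring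
  rw [h5, intervalIntegral.integral_const_mul] at h4
  rw [h4, hy t ht]
  simp [hz]

/-- Carathéodory's existence theorem for linear equations with bounded operator coefficients that
are merely measurable in time. -/
theorem exists_linear_ode_solution {X : Type*} [NormedAddCommGroup X] [NormedSpace ℂ X]
    [NormedSpace ℝ X] [CompleteSpace X] {T M : ℝ} (hT : 0 ≤ T)
    {L : ℝ → X →L[ℂ] X} (hL : AEStronglyMeasurable L (volume.restrict (Ioc 0 T)))
    (hM : ∀ t ∈ Ioc 0 T, ‖L t‖ ≤ M) {f : ℝ → X} (hf : IntervalIntegrable f volume 0 T) (y₀ : X) :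
    ∃ y : ℝ → X, ContinuousOn y (Icc 0 T) ∧
      ∀ t ∈ Icc 0 T, y t = y₀ + ∫ τ in (0 : ℝ)..t, (L τ (y τ) + f τ) := by
  -- The rate of an exponentially weighted norm: `|M| / lam ≤ 1/2` makes the Picard map a
  -- contraction on all of `[0,T]` at once, whatever `T` is.
  set lam : ℝ := 2 * |M| + 1 with hlam
  have hlam0 : 0 < lam := by positivity
  -- The fixed point is sought for `w(t) = e^{-lam t} y(t)`; `ext` recovers `y` from `w`, extended
  -- to the whole line.
  let ext : C(Icc (0 : ℝ) T, X) → ℝ → X := fun w t ↦ Real.exp (lam * t) • IccExtend hT w t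
  have hext : ∀ w, Continuous (ext w) := fun w ↦
    (by fun_prop : Continuous fun t ↦ Real.exp (lam * t)).smul (w.continuous.Icc_extend')
  have hmeas : ∀ w, AEStronglyMeasurable (fun τ ↦ L τ (ext w τ)) (volume.restrict (Ioc 0 T)) :=
    fun w ↦ (ContinuousLinearMap.apply ℂ X).flip.aestronglyMeasurable_comp₂ hL
      (hext w).aestronglyMeasurable
  have hint1 : ∀ w, IntervalIntegrable (fun τ ↦ L τ (ext w τ)) volume 0 T := by
    intro w
    obtain ⟨C, hC⟩ := isCompact_Icc.exists_bound_of_continuousOn (s := Icc 0 T)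
      (hext w).continuousOn
    rw [intervalIntegrable_iff_integrableOn_Ioc_of_le hT]
    refine Integrable.of_bound (hmeas w) (M * C) ?_
    filter_upwards [ae_restrict_mem measurableSet_Ioc] with τ hτ
    refine ((L τ).le_opNorm _).trans ?_
    exact mul_le_mul (hM τ hτ) (hC τ (Ioc_subset_Icc_self hτ)) (norm_nonneg _)
      ((norm_nonneg _).trans (hM τ hτ))
  have hint : ∀ w, IntervalIntegrable (fun τ ↦ L τ (ext w τ) + f τ) volume 0 T :=
    fun w ↦ (hint1 w).add hf
  let Φ : C(Icc (0 : ℝ) T, X) → C(Icc (0 : ℝ) T, X) := fun w ↦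
    ⟨fun t ↦ Real.exp (-(lam * t)) • (y₀ + ∫ τ in (0 : ℝ)..t, (L τ (ext w τ) + f τ)), by
      have h1 := continuousOn_iff_continuous_domRestrict.1 (continuousOn_intervalIntegral hT (hint w))
      exact (by fun_prop : Continuous fun t : Icc (0 : ℝ) T ↦ Real.exp (-(lam * t))).smul
        (continuous_const.add h1)⟩
  have hK : ContractingWith (1 / 2) Φ := by
    refine ⟨by rw [← NNReal.coe_lt_coe]; norm_num, ?_⟩
    refine LipschitzWith.of_dist_le_mul fun v w ↦ ?_
    rw [ContinuousMap.dist_le (by positivity)]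
    intro t
    have ht := t.2
    have hsub : uIcc (0 : ℝ) t ⊆ uIcc 0 T := by
      rw [uIcc_of_le ht.1, uIcc_of_le hT]; exact Icc_subset_Icc_right ht.2
    have h1 : Φ v t - Φ w t = Real.exp (-(lam * t)) •
        ∫ τ in (0 : ℝ)..t, L τ (ext v τ - ext w τ) := by
      simp only [Φ, ContinuousMap.coe_mk, ← smul_sub, add_sub_add_left_eq_sub]
      rw [← intervalIntegral.integral_sub ((hint v).mono_set hsub) ((hint w).mono_set hsub)]
      simp
    rw [dist_eq_norm, h1, norm_smul, Real.norm_eq_abs, abs_of_pos (Real.exp_pos _)]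
    have h2 : ‖∫ τ in (0 : ℝ)..t, L τ (ext v τ - ext w τ)‖ ≤
        ∫ τ in (0 : ℝ)..t, |M| * dist v w * Real.exp (lam * τ) := by
      refine intervalIntegral.norm_integral_le_of_norm_le ht.1 ?_
        ((by fun_prop : Continuous fun τ : ℝ ↦ |M| * dist v w * Real.exp (lam * τ)
          ).intervalIntegrable _ _)
      refine Eventually.of_forall fun τ hτ ↦ ?_
      have hτT : τ ∈ Ioc 0 T := ⟨hτ.1, hτ.2.trans ht.2⟩
      refine ((L τ).le_opNorm _).trans ?_
      have h3 : ‖ext v τ - ext w τ‖ ≤ Real.exp (lam * τ) * dist v w := by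
        simp only [ext, ← smul_sub]
        rw [norm_smul, Real.norm_eq_abs, abs_of_pos (Real.exp_pos _), ← dist_eq_norm]
        gcongr
        exact ContinuousMap.dist_apply_le_dist _
      calc _ ≤ |M| * (Real.exp (lam * τ) * dist v w) := by
            gcongr; exact (hM τ hτT).trans (le_abs_self M)
        _ = _ := by ring
    rw [intervalIntegral.integral_const_mul] at h2
    have h4 : ∫ τ in (0 : ℝ)..t, Real.exp (lam * τ) = lam⁻¹ * (Real.exp (lam * t) - 1) := by
      rw [intervalIntegral.integral_comp_mul_left _ hlam0.ne']
      simp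
    rw [h4] at h2
    have h5 : Real.exp (-(lam * t)) * Real.exp (lam * t) = 1 := by rw [← Real.exp_add]; simp
    have h6 : |M| * lam⁻¹ ≤ 1 / 2 := by
      rw [← div_eq_mul_inv, div_le_iff₀ hlam0, hlam]; linarith
    calc Real.exp (-(lam * t)) * ‖∫ τ in (0 : ℝ)..t, L τ (ext v τ - ext w τ)‖
        ≤ Real.exp (-(lam * t)) * (|M| * dist v w * (lam⁻¹ * (Real.exp (lam * t) - 1))) := by
          gcongr
      _ ≤ Real.exp (-(lam * t)) * (|M| * dist v w * (lam⁻¹ * Real.exp (lam * t))) := by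
          gcongr; linarith
      _ = |M| * lam⁻¹ * dist v w * (Real.exp (-(lam * t)) * Real.exp (lam * t)) := by ring
      _ ≤ _ := by rw [h5, mul_one]; push_cast; gcongr
  have : Nonempty (Icc (0 : ℝ) T) := ⟨⟨0, le_rfl, hT⟩⟩
  set w := hK.fixedPoint Φ
  have hw : Φ w = w := hK.fixedPoint_isFixedPt
  refine ⟨ext w, (hext w).continuousOn, fun t ht ↦ ?_⟩
  have h1 : w ⟨t, ht⟩ = Φ w ⟨t, ht⟩ := by rw [hw]
  simp only [ext, IccExtend_of_mem hT w ht]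
  rw [h1]
  simp only [Φ, ContinuousMap.coe_mk, smul_smul, ← Real.exp_add]
  simp [ext]

/-! ### Density of compactly supported test functions -/

/-- Schwartz functions are limits of compactly supported ones. -/
theorem exists_hasCompactSupport_tendsto {E : Type*} [NormedAddCommGroup E]
    [NormedSpace ℝ E] [FiniteDimensional ℝ E] (φ : 𝓢(E, ℂ)) :
    ∃ ψ : ℕ → 𝓢(E, ℂ), (∀ n, HasCompactSupport (ψ n)) ∧ Tendsto ψ atTop (𝓝 φ) := by
  obtain ⟨χ, hχs, hχc, hχ1⟩ : ∃ χ : E → ℂ, ContDiff ℝ ∞ χ ∧ HasCompactSupport χ ∧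
      ∀ x, ‖x‖ < 1 → χ x = 1 := by
    let b : ContDiffBump (0 : E) := ⟨1, 2, by norm_num, by norm_num⟩
    refine ⟨fun x ↦ (b x : ℂ), ?_, ?_, ?_⟩
    · exact Complex.ofRealCLM.contDiff.comp b.contDiff
    · exact b.hasCompactSupport.comp_left (g := Complex.ofReal) rfl
    · intro x hx
      have : b x = 1 := b.one_of_mem_closedBall (by simpa [b] using hx.le)
      simp [this]
  have hbound : ∀ i, ∃ C, ∀ x, ‖iteratedFDeriv ℝ i χ x‖ ≤ C := fun i ↦
    (hχs.continuous_iteratedFDeriv (mod_cast le_top)).bounded_above_of_compact_support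
      (hχc.iteratedFDeriv i)
  choose C hC using hbound
  have hC0 : ∀ i, 0 ≤ C i := fun i ↦ (norm_nonneg _).trans (hC i 0)
  let c : ℕ → ℝ := fun n ↦ ((n : ℝ) + 1)⁻¹
  have hc0 : ∀ n, 0 < c n := fun n ↦ by positivity
  have hc1 : ∀ n, c n ≤ 1 := fun n ↦ inv_le_one_of_one_le₀ (by simp)
  let χn : ℕ → E → ℂ := fun n x ↦ χ (c n • x)
  have hχns : ∀ n, ContDiff ℝ ∞ (χn n) := fun n ↦ hχs.comp (contDiff_const_smul _)
  have hχnc : ∀ n, HasCompactSupport (χn n) := fun n ↦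
    hχc.comp_homeomorph (Homeomorph.smulOfNeZero (c n) (hc0 n).ne')
  have hprodc : ∀ n, HasCompactSupport (fun x ↦ χn n x * φ x) := fun n ↦ (hχnc n).mul_right
  have hprods : ∀ n, ContDiff ℝ ∞ (fun x ↦ χn n x * φ x) := fun n ↦ (hχns n).mul (φ.smooth ⊤)
  let ψ : ℕ → 𝓢(E, ℂ) := fun n ↦ (hprodc n).toSchwartzMap (hprods n)
  refine ⟨ψ, fun n ↦ hprodc n, ?_⟩
  rw [(schwartz_withSeminorms ℝ E ℂ).tendsto_nhds ψ φ]
  rintro ⟨k, m⟩ ε hε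
  simp only [SchwartzMap.schwartzSeminormFamily_apply]
  set A : ℝ := SchwartzMap.seminorm ℝ (k + 1) m φ +
    ∑ i ∈ Finset.range (m + 1), (m.choose i) * C i * SchwartzMap.seminorm ℝ (k + 1) (m - i) φ
  have hA : 0 ≤ A := add_nonneg (apply_nonneg _ _) (Finset.sum_nonneg fun i _ ↦
    mul_nonneg (mul_nonneg (by positivity) (hC0 i)) (apply_nonneg _ _))
  -- Where `‖c n • x‖ < 1` the cutoff is `1` and the difference vanishes near `x`. Elsewhere `1 ≤ c
  -- n * ‖x‖`, so one more power of `‖x‖` in the seminorm buys a factor `c n`; derivatives of the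
  -- dilated cutoff stay bounded since `c n ≤ 1`.
  have key : ∀ n, SchwartzMap.seminorm ℝ k m (ψ n - φ) ≤ c n * A := by
    intro n
    refine SchwartzMap.seminorm_le_bound ℝ k m _ (mul_nonneg (hc0 n).le hA) fun x ↦ ?_
    by_cases hx : ‖c n • x‖ < 1
    · have h0 : (⇑(ψ n - φ) : E → ℂ) =ᶠ[𝓝 x] fun _ ↦ 0 := by
        have : ∀ᶠ z in 𝓝 x, ‖c n • z‖ < 1 :=
          (continuous_const_smul (c n)).norm.continuousAt.eventually_lt continuousAt_const hx
        filter_upwards [this] with z hz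
        have h1 : (ψ n - φ) z = χn n z * φ z - φ z := rfl
        rw [h1]
        simp [χn, hχ1 _ hz]
      rw [(h0.iteratedFDeriv ℝ m).eq_of_nhds]
      have h2 : iteratedFDeriv ℝ m (fun _ : E ↦ (0 : ℂ)) x = 0 := by
        simp
      rw [h2]
      simpa using mul_nonneg (hc0 n).le hA
    · have hx1 : 1 ≤ c n * ‖x‖ := by
        rw [norm_smul, Real.norm_eq_abs, abs_of_pos (hc0 n)] at hx
        exact not_lt.1 hx
      have h1 : (⇑(ψ n - φ) : E → ℂ) = (fun x ↦ χn n x * φ x) - ⇑φ := rfl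
      have h2 : ‖iteratedFDeriv ℝ m (⇑(ψ n - φ)) x‖ ≤ ‖iteratedFDeriv ℝ m φ x‖ +
          ∑ i ∈ Finset.range (m + 1), (m.choose i) * C i * ‖iteratedFDeriv ℝ (m - i) φ x‖ := by
        rw [h1, iteratedFDeriv_sub_apply (((hprods n).of_le (mod_cast le_top)).contDiffAt)
          (φ.contDiffAt (m : ℕ∞))]
        refine (norm_sub_le _ _).trans ?_
        rw [add_comm]
        gcongr
        refine (norm_iteratedFDeriv_mul_le (N := ∞) (hχns n) (φ.smooth ⊤) x (mod_cast le_top)).trans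
          (Finset.sum_le_sum fun i _ ↦ ?_)
        gcongr
        have h3 : iteratedFDeriv ℝ i (χn n) x = c n ^ i • iteratedFDeriv ℝ i χ (c n • x) :=
          congrFun (iteratedFDeriv_comp_const_smul (c n) (hχs.of_le (mod_cast le_top))) x
        rw [h3, norm_smul, norm_pow, Real.norm_eq_abs, abs_of_pos (hc0 n)]
        calc _ ≤ 1 * C i := by
              gcongr
              · exact pow_le_one₀ (hc0 n).le (hc1 n)
              · exact hC i _
          _ = C i := one_mul _
      have h4 : ∀ l, ‖x‖ ^ k * ‖iteratedFDeriv ℝ l φ x‖ ≤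
          c n * SchwartzMap.seminorm ℝ (k + 1) l φ := by
        intro l
        calc ‖x‖ ^ k * ‖iteratedFDeriv ℝ l φ x‖
            ≤ (c n * ‖x‖) * (‖x‖ ^ k * ‖iteratedFDeriv ℝ l φ x‖) :=
              le_mul_of_one_le_left (by positivity) hx1
          _ = c n * (‖x‖ ^ (k + 1) * ‖iteratedFDeriv ℝ l φ x‖) := by ring
          _ ≤ _ := by
            gcongr
            exact SchwartzMap.le_seminorm ℝ (k + 1) l φ x
      calc ‖x‖ ^ k * ‖iteratedFDeriv ℝ m (⇑(ψ n - φ)) x‖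
          ≤ ‖x‖ ^ k * (‖iteratedFDeriv ℝ m φ x‖ +
          ∑ i ∈ Finset.range (m + 1), (m.choose i) * C i * ‖iteratedFDeriv ℝ (m - i) φ x‖) := by
            gcongr
        _ = ‖x‖ ^ k * ‖iteratedFDeriv ℝ m φ x‖ + ∑ i ∈ Finset.range (m + 1),
            (m.choose i) * C i * (‖x‖ ^ k * ‖iteratedFDeriv ℝ (m - i) φ x‖) := by
            rw [mul_add, Finset.mul_sum]
            congr 1
            exact Finset.sum_congr rfl fun i _ ↦ by ring
        _ ≤ c n * SchwartzMap.seminorm ℝ (k + 1) m φ + ∑ i ∈ Finset.range (m + 1),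
            (m.choose i) * C i * (c n * SchwartzMap.seminorm ℝ (k + 1) (m - i) φ) := by
            exact add_le_add (h4 m) (Finset.sum_le_sum fun i _ ↦
              mul_le_mul_of_nonneg_left (h4 _) (mul_nonneg (by positivity) (hC0 i)))
        _ = c n * A := by
            rw [mul_add, Finset.mul_sum]
            congr 1
            exact Finset.sum_congr rfl fun i _ ↦ by ring
  have hlim : Tendsto (fun n ↦ c n * A) atTop (𝓝 0) := by
    have := tendsto_one_div_add_atTop_nhds_zero_nat (𝕜 := ℝ)
    simpa [c] using this.mul_const A
  filter_upwards [hlim.eventually_lt_const hε] with n hn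
  exact (key n).trans_lt hn

/-- A tempered distribution is determined by its values on compactly supported functions. -/
theorem temperedDistribution_ext_of_hasCompactSupport {E : Type*} [NormedAddCommGroup E]
    [NormedSpace ℝ E] [FiniteDimensional ℝ E] {v w : 𝓢'(E, ℂ)}
    (h : ∀ φ : 𝓢(E, ℂ), HasCompactSupport φ → v φ = w φ) : v = w := by
  ext φ
  obtain ⟨ψ, hψ, hlim⟩ := exists_hasCompactSupport_tendsto φ
  have hv := ((map_continuous v).tendsto φ).comp hlim
  have hw := ((map_continuous w).tendsto φ).comp hlim
  refine tendsto_nhds_unique hv (hw.congr fun n ↦ ?_)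
  exact (h _ (hψ n)).symm

/-! ### Bounded Fourier multipliers and conjugate reflection on `L²` -/

/-- Scalar square integrable functions. -/
abbrev L2 (d : ℕ) : Type := Lp ℂ 2 (volume : Measure (Space d))

/-- A real, even, bounded Fourier multiplier. -/
structure BddSymbol (d : ℕ) where
  toFun : Space d → ℝ
  measurable : Measurable toFun
  bound : ∃ C, ∀ ξ, |toFun ξ| ≤ C
  even : ∀ ξ, toFun (-ξ) = toFun ξ

namespace BddSymbol

variable {d : ℕ}

instance : CoeFun (BddSymbol d) fun _ ↦ Space d → ℝ := ⟨toFun⟩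

theorem memLp_top (m : BddSymbol d) :
    MemLp (fun ξ ↦ (m ξ : ℂ)) ∞ (volume : Measure (Space d)) := by
  obtain ⟨C, hC⟩ := m.bound
  refine memLp_top_of_bound (Complex.measurable_ofReal.comp m.measurable).aestronglyMeasurable C
    (Eventually.of_forall fun ξ ↦ ?_)
  simpa using hC ξ

/-- Multiplication by a bounded symbol. -/
def op (m : BddSymbol d) : L2 d →L[ℂ] L2 d :=
  (ContinuousLinearMap.lsmul ℂ ℂ).holderL volume ∞ 2 2 (m.memLp_top.toLp _)

theorem op_eq_smul (m : BddSymbol d) (f : L2 d) :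
    m.op f = ((m.memLp_top.toLp _) • f : L2 d) := rfl

theorem coeFn_op (m : BddSymbol d) (f : L2 d) : m.op f =ᵐ[volume] fun ξ ↦ (m ξ : ℂ) * f ξ := by
  rw [op_eq_smul]
  filter_upwards [Lp.coeFn_lpSMul (r := 2) (m.memLp_top.toLp _) f, m.memLp_top.coeFn_toLp]
    with ξ h1 h2
  rw [h1]
  simp [h2]

/-- Comparing two factorisations avoids packaging the common product as a symbol with a bound of its
own. -/
theorem op_op_eq {m₁ m₂ m₃ m₄ : BddSymbol d} (h : ∀ ξ, m₁ ξ * m₂ ξ = m₃ ξ * m₄ ξ) (f : L2 d) :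
    m₁.op (m₂.op f) = m₃.op (m₄.op f) := by
  refine Lp.ext ?_
  filter_upwards [m₁.coeFn_op (m₂.op f), m₂.coeFn_op f, m₃.coeFn_op (m₄.op f), m₄.coeFn_op f]
    with ξ h1 h2 h3 h4
  rw [h1, h2, h3, h4, ← mul_assoc, ← mul_assoc, ← Complex.ofReal_mul, h, Complex.ofReal_mul]

theorem op_comm (m₁ m₂ : BddSymbol d) (f : L2 d) : m₁.op (m₂.op f) = m₂.op (m₁.op f) :=
  op_op_eq (fun _ ↦ mul_comm _ _) f

theorem op_op (m₁ m₂ m₃ : BddSymbol d) (h : ∀ ξ, m₁ ξ * m₂ ξ = m₃ ξ) (f : L2 d) :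
    m₁.op (m₂.op f) = m₃.op f := by
  refine Lp.ext ?_
  filter_upwards [m₁.coeFn_op (m₂.op f), m₂.coeFn_op f, m₃.coeFn_op f]
    with ξ h1 h2 h3
  rw [h1, h2, h3, ← mul_assoc, ← Complex.ofReal_mul, h]

theorem op_add_op (m₁ m₂ m₃ : BddSymbol d) (h : ∀ ξ, m₁ ξ + m₂ ξ = m₃ ξ) (f : L2 d) :
    m₁.op f + m₂.op f = m₃.op f := by
  refine Lp.ext ?_
  filter_upwards [m₁.coeFn_op f, m₂.coeFn_op f, m₃.coeFn_op f, Lp.coeFn_add (m₁.op f) (m₂.op f)]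
    with ξ h1 h2 h3 h4
  rw [h4, Pi.add_apply, h1, h2, h3, ← add_mul, ← Complex.ofReal_add, h]

theorem norm_op_le {m₁ m₂ : BddSymbol d} (h : ∀ ξ, |m₁ ξ| ≤ |m₂ ξ|) (f : L2 d) :
    ‖m₁.op f‖ ≤ ‖m₂.op f‖ := by
  refine Lp.norm_le_norm_of_ae_le ?_
  filter_upwards [m₁.coeFn_op f, m₂.coeFn_op f] with ξ h1 h2
  rw [h1, h2, norm_mul, norm_mul, Complex.norm_real, Complex.norm_real]
  exact mul_le_mul_of_nonneg_right (h ξ) (norm_nonneg _)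

theorem norm_op_le_self {m : BddSymbol d} (h : ∀ ξ, |m ξ| ≤ 1) (f : L2 d) :
    ‖m.op f‖ ≤ ‖f‖ := by
  refine Lp.norm_le_norm_of_ae_le ?_
  filter_upwards [m.coeFn_op f] with ξ h1
  rw [h1, norm_mul, Complex.norm_real]
  exact mul_le_of_le_one_left (norm_nonneg _) (h ξ)

/-- Self-adjointness: the symbol is real. -/
theorem inner_op_left (m : BddSymbol d) (f g : L2 d) :
    inner ℂ (m.op f) g = inner ℂ f (m.op g) := by
  rw [MeasureTheory.L2.inner_def, MeasureTheory.L2.inner_def]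
  refine integral_congr_ae ?_
  filter_upwards [m.coeFn_op f, m.coeFn_op g] with ξ h1 h2
  rw [h1, h2]
  simp
  ring

end BddSymbol

/-- The conjugate reflection `f ↦ conj (f (-·))`, under which Fourier transforms of real functions
are invariant. -/
def conjRefl (d : ℕ) : L2 d →L[ℝ] L2 d :=
  ((Complex.conjCLE : ℂ →L[ℝ] ℂ).compLpL 2 volume) ∘L
    (Lp.compMeasurePreservingₗᵢ ℝ (Neg.neg : Space d → Space d)
      (Measure.measurePreserving_neg volume)).toContinuousLinearMap

theorem coeFn_conjRefl {d : ℕ} (f : L2 d) :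
    conjRefl d f =ᵐ[volume] fun ξ ↦ (starRingEnd ℂ) (f (-ξ)) := by
  have h1 := (Complex.conjCLE : ℂ →L[ℝ] ℂ).coeFn_compLpL (p := 2) (μ := volume)
    (Lp.compMeasurePreserving (Neg.neg : Space d → Space d)
      (Measure.measurePreserving_neg volume) f)
  have h2 := Lp.coeFn_compMeasurePreserving f (Measure.measurePreserving_neg (volume : Measure (Space d)))
  filter_upwards [h1, h2] with ξ h1 h2
  refine h1.trans ?_
  rw [h2]
  simp

/-- Conjugation passes through the symbol because it is real, reflection because it is even. This is
the source of real-valued solutions. -/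
theorem conjRefl_op {d : ℕ} (m : BddSymbol d) (f : L2 d) :
    conjRefl d (m.op f) = m.op (conjRefl d f) := by
  refine Lp.ext ?_
  have h := (Measure.measurePreserving_neg (volume : Measure (Space d))).quasiMeasurePreserving.ae
    (m.coeFn_op f)
  filter_upwards [coeFn_conjRefl (m.op f), m.coeFn_op (conjRefl d f), coeFn_conjRefl f, h]
    with ξ h1 h2 h3 h4
  rw [h1, h2, h3, h4, m.even]
  simp

theorem conjRefl_conj_smul {d : ℕ} (c : ℂ) (f : L2 d) :
    conjRefl d (c • f) = (starRingEnd ℂ c) • conjRefl d f := by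
  refine Lp.ext ?_
  have h := (Measure.measurePreserving_neg (volume : Measure (Space d))).quasiMeasurePreserving.ae
    (Lp.coeFn_smul c f)
  filter_upwards [coeFn_conjRefl (c • f), Lp.coeFn_smul (starRingEnd ℂ c) (conjRefl d f),
    coeFn_conjRefl f, h] with ξ h1 h2 h3 h4
  rw [h1, h2, h4]
  simp [h3]

/-! ### Bessel weights and frequency representatives of Sobolev distributions -/

section BesselSymbol

variable {d : ℕ}

theorem besselSymbol_base_pos (ξ : Space d) : 0 < 1 + (2 * Real.pi * ‖ξ‖) ^ 2 := by positivity

theorem besselSymbol_pos (s : ℝ) (ξ : Space d) : 0 < besselSymbol d s ξ :=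
  Real.rpow_pos_of_pos (besselSymbol_base_pos ξ) _

theorem besselSymbol_mul (s r : ℝ) (ξ : Space d) :
    besselSymbol d s ξ * besselSymbol d r ξ = besselSymbol d (s + r) ξ := by
  rw [besselSymbol, besselSymbol, besselSymbol, ← Real.rpow_add (besselSymbol_base_pos ξ), add_div]

theorem besselSymbol_zero (ξ : Space d) : besselSymbol d 0 ξ = 1 := by
  simp [besselSymbol]

theorem besselSymbol_neg (s : ℝ) (ξ : Space d) : besselSymbol d s (-ξ) = besselSymbol d s ξ := by
  simp [besselSymbol]

theorem besselSymbol_neg_two (ξ : Space d) :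
    besselSymbol d (-2) ξ = (1 + (2 * Real.pi * ‖ξ‖) ^ 2)⁻¹ := by
  rw [besselSymbol, ← Real.rpow_neg_one]
  norm_num

theorem besselSymbol_le_one {s : ℝ} (hs : s ≤ 0) (ξ : Space d) : besselSymbol d s ξ ≤ 1 :=
  Real.rpow_le_one_of_one_le_of_nonpos (by nlinarith [sq_nonneg (2 * Real.pi * ‖ξ‖)]) (by linarith)

theorem measurable_besselSymbol (s : ℝ) : Measurable (besselSymbol d s) := by
  unfold besselSymbol
  fun_prop

end BesselSymbol

/-- The symbol of `(1 - Δ)^{s/2}` for `s ≤ 0`. -/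
def negBessel (d : ℕ) (s : ℝ) (hs : s ≤ 0) : BddSymbol d where
  toFun := besselSymbol d s
  measurable := measurable_besselSymbol s
  bound := ⟨1, fun ξ ↦ by
    rw [abs_of_pos (besselSymbol_pos s ξ)]; exact besselSymbol_le_one hs ξ⟩
  even := besselSymbol_neg s

theorem abs_mul_coord_le {d : ℕ} (i j : Fin d) (ξ : Space d) : |ξ i * ξ j| ≤ ‖ξ‖ ^ 2 := by
  have hi := PiLp.norm_apply_le ξ i
  have hj := PiLp.norm_apply_le ξ j
  rw [abs_mul, sq]
  exact mul_le_mul hi hj (abs_nonneg _) (norm_nonneg _)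

/-- The symbol of `∂_i ∂_j (1 - Δ)⁻¹`. -/
def hessSymbol {d : ℕ} (i j : Fin d) : BddSymbol d where
  toFun ξ := -((2 * Real.pi) ^ 2 * (ξ i * ξ j)) * besselSymbol d (-2) ξ
  measurable := by
    have := measurable_besselSymbol (d := d) (-2)
    fun_prop
  bound := ⟨1, fun ξ ↦ by
    rw [abs_mul, abs_neg, abs_mul, abs_of_pos (besselSymbol_pos _ ξ), besselSymbol_neg_two,
      ← div_eq_mul_inv, div_le_one (besselSymbol_base_pos ξ), abs_of_pos (by positivity)]
    have := mul_le_mul_of_nonneg_left (abs_mul_coord_le i j ξ)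
      (by positivity : 0 ≤ (2 * Real.pi) ^ 2)
    nlinarith⟩
  even ξ := by simp [besselSymbol_neg]

/-- The element of `H^s_2` whose image under `(1 - Δ)^{s/2}` has Fourier transform `h`. -/
def freqDist {d : ℕ} (s : ℝ) : L2 d →L[ℂ] 𝓢'(Space d, ℂ) :=
  FourierTransform.fourierInvCLM ℂ 𝓢'(Space d, ℂ) ∘L
    TemperedDistribution.smulLeftCLM ℂ (fun ξ ↦ (besselSymbol d (-s) ξ : ℂ)) ∘L
      Lp.toTemperedDistributionCLM ℂ volume 2

section FreqDist

variable {d : ℕ}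

theorem freqDist_eq (s : ℝ) (h : L2 d) : freqDist s h =
    𝓕⁻ (TemperedDistribution.smulLeftCLM ℂ (fun ξ ↦ (besselSymbol d (-s) ξ : ℂ))
      (h : 𝓢'(Space d, ℂ))) := rfl

theorem freqDist_apply (s : ℝ) (h : L2 d) (φ : 𝓢(Space d, ℂ)) :
    freqDist s h φ = ∫ ξ, (besselSymbol d (-s) ξ : ℂ) * (𝓕⁻ φ) ξ * h ξ := by
  rw [freqDist_eq, TemperedDistribution.fourierInv_apply,
    TemperedDistribution.smulLeftCLM_apply_apply, Lp.toTemperedDistribution_apply]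
  simp [SchwartzMap.smulLeftCLM_apply_apply (besselSymbol_hasTemperateGrowth d (-s))]

theorem smulLeftCLM_bessel_bessel (s r : ℝ) (v : 𝓢'(Space d, ℂ)) :
    TemperedDistribution.smulLeftCLM ℂ (fun ξ ↦ (besselSymbol d s ξ : ℂ))
      (TemperedDistribution.smulLeftCLM ℂ (fun ξ ↦ (besselSymbol d r ξ : ℂ)) v) =
    TemperedDistribution.smulLeftCLM ℂ (fun ξ ↦ (besselSymbol d (s + r) ξ : ℂ)) v := by
  rw [TemperedDistribution.smulLeftCLM_smulLeftCLM_apply (besselSymbol_hasTemperateGrowth d r)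
    (besselSymbol_hasTemperateGrowth d s)]
  congr 2
  funext ξ
  simp only [Pi.mul_apply]
  rw [← Complex.ofReal_mul, besselSymbol_mul, add_comm]

theorem smulLeftCLM_bessel_zero (v : 𝓢'(Space d, ℂ)) :
    TemperedDistribution.smulLeftCLM ℂ (fun ξ ↦ (besselSymbol d 0 ξ : ℂ)) v = v := by
  simp [besselSymbol_zero]

/-- The weight of order `-s` inside `freqDist s` cancels the symbol of `(1-Δ)^{s/2}`, leaving only
the inverse Fourier transform. -/
theorem bessel_freqDist (s : ℝ) (h : L2 d) :
    bessel s (freqDist s h) = ((𝓕⁻ h : L2 d) : 𝓢'(Space d, ℂ)) := by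
  rw [bessel, TemperedDistribution.fourierMultiplierCLM_apply, freqDist_eq,
    FourierTransform.fourier_fourierInv_eq, smulLeftCLM_bessel_bessel, add_neg_cancel,
    smulLeftCLM_bessel_zero, Lp.fourierInv_toTemperedDistribution_eq]

theorem toTemperedDistribution_injective {g g' : L2 d}
    (h : (g : 𝓢'(Space d, ℂ)) = (g' : 𝓢'(Space d, ℂ))) : g = g' := by
  have := Lp.ker_toTemperedDistributionCLM_eq_bot (F := ℂ) (μ := (volume : Measure (Space d)))
    (p := 2)
  exact LinearMap.ker_eq_bot.1 this h

theorem freqDist_injective (s : ℝ) : Function.Injective (freqDist s : L2 d → 𝓢'(Space d, ℂ)) := by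
  intro h h' e
  have := congrArg (bessel s) e
  rw [bessel_freqDist, bessel_freqDist] at this
  have := congrArg (fun g : L2 d ↦ 𝓕 g) (toTemperedDistribution_injective this)
  simpa using this

theorem freqDist_fourier_of_bessel_eq {s : ℝ} {v : 𝓢'(Space d, ℂ)} {g : L2 d}
    (h : bessel s v = (g : 𝓢'(Space d, ℂ))) : freqDist s (𝓕 g : L2 d) = v := by
  rw [bessel, TemperedDistribution.fourierMultiplierCLM_apply] at h
  rw [freqDist_eq, ← Lp.fourier_toTemperedDistribution_eq, ← h,
    FourierTransform.fourier_fourierInv_eq, smulLeftCLM_bessel_bessel, neg_add_cancel,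
    smulLeftCLM_bessel_zero, FourierTransform.fourierInv_fourier_eq]

theorem memScalarH_freqDist (s : ℝ) (h : L2 d) : MemScalarH s (freqDist s h) :=
  ⟨_, bessel_freqDist s h⟩

theorem besselRep_spec {s : ℝ} {v : 𝓢'(Space d, ℂ)} (h : MemScalarH s v) :
    bessel s v = (besselRep s v : 𝓢'(Space d, ℂ)) := by
  rw [besselRep, dif_pos h]
  exact h.choose_spec

theorem besselRep_freqDist (s : ℝ) (h : L2 d) : besselRep s (freqDist s h) = 𝓕⁻ h := by
  apply toTemperedDistribution_injective
  rw [← besselRep_spec (memScalarH_freqDist s h), bessel_freqDist]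

theorem freqDist_fourier_besselRep {s : ℝ} {v : 𝓢'(Space d, ℂ)} (h : MemScalarH s v) :
    freqDist s (𝓕 (besselRep s v) : L2 d) = v :=
  freqDist_fourier_of_bessel_eq (besselRep_spec h)

theorem toTemperedDistribution_op (m : BddSymbol d)
    (hm : (fun ξ ↦ (m ξ : ℂ)).HasTemperateGrowth) (h : L2 d) :
    ((m.op h : L2 d) : 𝓢'(Space d, ℂ)) =
      TemperedDistribution.smulLeftCLM ℂ (fun ξ ↦ (m ξ : ℂ)) (h : 𝓢'(Space d, ℂ)) := by
  rw [BddSymbol.op_eq_smul]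
  exact Lp.toTemperedDistribution_smul_eq hm m.memLp_top h

/-- The inclusion of `H^{s-r}` in `H^s` for `r ≤ 0`, seen on representatives. It lets the levels
`γ`, `γ+1`, `γ+2` be compared inside a single `L²`. -/
theorem freqDist_negBessel (s r : ℝ) (hr : r ≤ 0) (h : L2 d) :
    freqDist s ((negBessel d r hr).op h) = freqDist (s - r) h := by
  rw [freqDist_eq, toTemperedDistribution_op _ (besselSymbol_hasTemperateGrowth d r), freqDist_eq,
    show -(s - r) = -s + r by ring, ← smulLeftCLM_bessel_bessel]
  rfl

theorem hasTemperateGrowth_coord (i : Fin d) : (fun ξ : Space d ↦ (ξ i : ℂ)).HasTemperateGrowth :=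
  (Complex.ofRealCLM ∘L (EuclideanSpace.proj i : Space d →L[ℝ] ℝ)).hasTemperateGrowth

theorem hasTemperateGrowth_hessSymbol (i j : Fin d) :
    (fun ξ : Space d ↦ (hessSymbol i j ξ : ℂ)).HasTemperateGrowth := by
  have h1 := hasTemperateGrowth_coord i
  have h2 := hasTemperateGrowth_coord j
  have h3 := besselSymbol_hasTemperateGrowth d (-2)
  have : (fun ξ : Space d ↦ (hessSymbol i j ξ : ℂ)) = fun ξ : Space d ↦
      (-((2 * Real.pi : ℂ) ^ 2)) * (((ξ i : ℂ) * (ξ j : ℂ)) * (besselSymbol d (-2) ξ : ℂ)) := by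
    funext ξ
    simp only [hessSymbol]
    push_cast
    ring
  rw [this]
  fun_prop

theorem lineDeriv_single (i : Fin d) (v : 𝓢'(Space d, ℂ)) :
    ∂_{(EuclideanSpace.single i (1 : ℝ) : Space d)} v =
      (2 * Real.pi * Complex.I) • 𝓕⁻ (TemperedDistribution.smulLeftCLM ℂ
        (fun ξ : Space d ↦ (ξ i : ℂ)) (𝓕 v)) := by
  rw [TemperedDistribution.lineDeriv_eq_fourierMultiplierCLM,
    TemperedDistribution.fourierMultiplierCLM_apply]
  simp [EuclideanSpace.inner_single_right]

/-- Two derivatives produce `(2πi)² ξ_i ξ_j`, and lowering the Sobolev index by two supplies the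
weight `(1+|2πξ|²)⁻¹` that makes this factor bounded. -/
theorem hessian_freqDist (s : ℝ) (i j : Fin d) (h : L2 d) :
    ∂_{(EuclideanSpace.single i (1 : ℝ) : Space d)}
      (∂_{(EuclideanSpace.single j (1 : ℝ) : Space d)} (freqDist (s + 2) h)) =
    freqDist s ((hessSymbol i j).op h) := by
  have h1 := hasTemperateGrowth_coord i
  have h2 := hasTemperateGrowth_coord j
  have h3 := besselSymbol_hasTemperateGrowth d (-(s + 2))
  rw [lineDeriv_single, lineDeriv_single, freqDist_eq, freqDist_eq,
    FourierTransform.fourier_fourierInv_eq, FourierTransform.fourier_smul,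
    FourierTransform.fourier_fourierInv_eq,
    toTemperedDistribution_op _ (hasTemperateGrowth_hessSymbol i j),
    TemperedDistribution.smulLeftCLM_smulLeftCLM_apply h3 h2, map_smul,
    TemperedDistribution.smulLeftCLM_smulLeftCLM_apply (by fun_prop) h1,
    TemperedDistribution.smulLeftCLM_smulLeftCLM_apply (hasTemperateGrowth_hessSymbol i j)
      (besselSymbol_hasTemperateGrowth d (-s)),
    FourierTransform.fourierInv_smul, smul_smul, ← FourierTransform.fourierInv_smul]
  have hg : ((((fun ξ : Space d ↦ (besselSymbol d (-(s + 2)) ξ : ℂ)) * fun ξ : Space d ↦ (ξ j : ℂ)) *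
      fun ξ : Space d ↦ (ξ i : ℂ))).HasTemperateGrowth := by fun_prop
  rw [← smul_apply, ← TemperedDistribution.smulLeftCLM_smul hg]
  congr 3
  funext ξ
  have h4 : besselSymbol d (-(s + 2)) ξ = besselSymbol d (-2) ξ * besselSymbol d (-s) ξ := by
    rw [besselSymbol_mul]; congr 1; ring
  simp only [Pi.smul_apply, Pi.mul_apply, smul_eq_mul, hessSymbol, h4]
  push_cast
  linear_combination (4 * (Real.pi : ℂ) ^ 2 * besselSymbol d (-2) ξ * besselSymbol d (-s) ξ *
    ξ i * ξ j) * Complex.I_sq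

/-- Complex conjugation of Schwartz functions. -/
def schwartzConj : 𝓢(Space d, ℂ) →L[ℝ] 𝓢(Space d, ℂ) :=
  SchwartzMap.postcompCLM (Complex.conjCLE : ℂ →L[ℝ] ℂ)

theorem schwartzConj_apply (φ : 𝓢(Space d, ℂ)) (x : Space d) :
    schwartzConj φ x = (starRingEnd ℂ) (φ x) := rfl

theorem isRealDistribution_iff (v : 𝓢'(Space d, ℂ)) :
    IsRealDistribution v ↔ ∀ φ, v (schwartzConj φ) = (starRingEnd ℂ) (v φ) := by
  constructor
  · intro hv φ
    -- Both `φ + conj φ` and `i(φ - conj φ)` are real-valued; testing on them yields the imaginary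
    -- and the real part of the identity.
    have h1 := hv (φ + schwartzConj φ) fun x ↦ by
      rw [add_apply, schwartzConj_apply]; simp
    have h2 := hv (Complex.I • (φ - schwartzConj φ)) fun x ↦ by
      rw [smul_apply, sub_apply, schwartzConj_apply]; simp
    simp only [map_add, map_smul, map_sub, Complex.add_im, smul_eq_mul, Complex.mul_im,
      Complex.I_re, Complex.I_im, Complex.sub_re, Complex.sub_im] at h1 h2
    apply Complex.ext
    · simp only [Complex.conj_re]; linarith
    · simp only [Complex.conj_im]; linarith
  · intro h φ hφ
    have h1 : schwartzConj φ = φ := by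
      ext x
      rw [schwartzConj_apply, Complex.conj_eq_iff_im]
      exact hφ x
    have h2 := h φ
    rw [h1] at h2
    exact Complex.conj_eq_iff_im.1 h2.symm

theorem fourierInv_schwartzConj (φ : 𝓢(Space d, ℂ)) (ξ : Space d) :
    (𝓕⁻ (schwartzConj φ)) ξ = (starRingEnd ℂ) ((𝓕⁻ φ) (-ξ)) := by
  rw [SchwartzMap.fourierInv_coe, SchwartzMap.fourierInv_coe, Real.fourierInv_eq',
    Real.fourierInv_eq', ← integral_conj]
  refine integral_congr_ae (Eventually.of_forall fun x ↦ ?_)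
  simp only [schwartzConj_apply, smul_eq_mul, map_mul, ← Complex.exp_conj]
  simp [Complex.conj_ofNat]

theorem freqDist_conjRefl (s : ℝ) (h : L2 d) (φ : 𝓢(Space d, ℂ)) :
    freqDist s (conjRefl d h) (schwartzConj φ) = (starRingEnd ℂ) (freqDist s h φ) := by
  rw [freqDist_apply, freqDist_apply, ← integral_conj,
    ← integral_neg_eq_self (fun ξ ↦ (starRingEnd ℂ) _)]
  refine integral_congr_ae ?_
  filter_upwards [coeFn_conjRefl h] with ξ hξ
  rw [hξ, fourierInv_schwartzConj]
  simp [besselSymbol_neg]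

/-- A distribution is real exactly when its Fourier transform is conjugate-symmetric, and the real
even Bessel weight preserves this symmetry. -/
theorem isRealDistribution_freqDist_iff (s : ℝ) (h : L2 d) :
    IsRealDistribution (freqDist s h) ↔ conjRefl d h = h := by
  rw [isRealDistribution_iff]
  constructor
  · intro H
    apply freqDist_injective s
    ext φ
    have h1 : schwartzConj (schwartzConj φ) = φ := by
      ext x; simp [schwartzConj_apply]
    rw [← h1, freqDist_conjRefl, ← H]
  · intro H φ
    rw [← freqDist_conjRefl, H]

end FreqDist

/-! ### The Laplacian symbol and frequency cutoffs -/

/-- The symbol of `-Δ (1 - Δ)⁻¹`. -/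
def lapSymbol (d : ℕ) : BddSymbol d where
  toFun ξ := (2 * Real.pi * ‖ξ‖) ^ 2 * besselSymbol d (-2) ξ
  measurable := by
    have := measurable_besselSymbol (d := d) (-2)
    fun_prop
  bound := ⟨1, fun ξ ↦ by
    rw [abs_of_nonneg (mul_nonneg (sq_nonneg _) (besselSymbol_pos _ ξ).le), besselSymbol_neg_two,
      ← div_eq_mul_inv, div_le_one (besselSymbol_base_pos ξ)]
    linarith⟩
  even ξ := by simp [besselSymbol_neg]

/-- The sharp frequency cutoff. -/
def cutoff (d : ℕ) (n : ℕ) : BddSymbol d where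
  toFun := indicator (Metric.closedBall 0 n) 1
  measurable := measurable_one.indicator Metric.isClosed_closedBall.measurableSet
  bound := ⟨1, fun ξ ↦ by
    by_cases h : ξ ∈ Metric.closedBall (0 : Space d) n <;> simp [h]⟩
  even ξ := by simp [indicator]

/-- The symbol of `√(-Δ)`, cut off. -/
def gradCutoff (d : ℕ) (n : ℕ) : BddSymbol d where
  toFun := indicator (Metric.closedBall 0 n) fun ξ ↦ 2 * Real.pi * ‖ξ‖
  measurable := by
    refine Measurable.indicator ?_ Metric.isClosed_closedBall.measurableSet
    fun_prop
  bound := ⟨2 * Real.pi * n, fun ξ ↦ by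
    by_cases h : ξ ∈ Metric.closedBall (0 : Space d) n
    · rw [indicator_of_mem h, abs_of_nonneg (by positivity)]
      have := mem_closedBall_zero_iff.1 h
      gcongr
    · rw [indicator_of_notMem h, abs_zero]; positivity⟩
  even ξ := by simp [indicator]

/-- The symbol of `1 - Δ`, cut off. -/
def besselCutoff (d : ℕ) (n : ℕ) : BddSymbol d where
  toFun := indicator (Metric.closedBall 0 n) (besselSymbol d 2)
  measurable := (measurable_besselSymbol 2).indicator Metric.isClosed_closedBall.measurableSet
  bound := ⟨1 + (2 * Real.pi * n) ^ 2, fun ξ ↦ by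
    by_cases h : ξ ∈ Metric.closedBall (0 : Space d) n
    · rw [indicator_of_mem h, abs_of_pos (besselSymbol_pos _ _), besselSymbol, div_self two_ne_zero,
        Real.rpow_one]
      have := mem_closedBall_zero_iff.1 h
      gcongr
    · rw [indicator_of_notMem h, abs_zero]; positivity⟩
  even ξ := by simp [indicator, besselSymbol_neg]

/-- The symbol of the identity. -/
def oneSymbol (d : ℕ) : BddSymbol d where
  toFun _ := 1
  measurable := measurable_const
  bound := ⟨1, by simp⟩
  even _ := rfl

theorem oneSymbol_op {d : ℕ} (f : L2 d) : (oneSymbol d).op f = f := by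
  refine Lp.ext ?_
  filter_upwards [(oneSymbol d).coeFn_op f] with ξ h
  rw [h]; simp [oneSymbol]

theorem norm_sq_lp_two {α E : Type*} [MeasurableSpace α] {μ : Measure α} [NormedAddCommGroup E]
    [InnerProductSpace ℂ E] (g : Lp E 2 μ) : ‖g‖ ^ 2 = ∫ x, ‖g x‖ ^ 2 ∂μ := by
  have h := norm_sq_eq_re_inner (𝕜 := ℂ) g
  rw [L2.inner_def] at h
  rw [h, ← integral_re (L2.integrable_inner g g)]
  exact integral_congr_ae (Eventually.of_forall fun x ↦ (norm_sq_eq_re_inner (𝕜 := ℂ) (g x)).symm)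

theorem integrable_norm_sq {α E : Type*} [MeasurableSpace α] {μ : Measure α}
    [NormedAddCommGroup E] {g : α → E} (hg : MemLp g 2 μ) : Integrable (fun x ↦ ‖g x‖ ^ 2) μ :=
  (memLp_two_iff_integrable_sq_norm hg.1).1 hg

/-- The error is the part of `f` outside a ball growing to the whole space, so dominated convergence
applies to its square. -/
theorem tendsto_cutoff_op {d : ℕ} (f : L2 d) :
    Tendsto (fun n ↦ (cutoff d n).op f) atTop (𝓝 f) := by
  rw [tendsto_iff_norm_sub_tendsto_zero]
  have h1 : ∀ n, ‖(cutoff d n).op f - f‖ ^ 2 =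
      ∫ ξ, ‖(Metric.closedBall (0 : Space d) n)ᶜ.indicator f ξ‖ ^ 2 := by
    intro n
    rw [norm_sq_lp_two]
    refine integral_congr_ae ?_
    filter_upwards [(cutoff d n).coeFn_op f, Lp.coeFn_sub ((cutoff d n).op f) f] with ξ h h'
    rw [h', Pi.sub_apply, h]
    by_cases hξ : ξ ∈ Metric.closedBall (0 : Space d) n
    · rw [indicator_of_notMem (by simpa using hξ)]; simp [cutoff, hξ]
    · rw [indicator_of_mem (by simpa using hξ)]; simp [cutoff, hξ]
  have h2 : Tendsto (fun n : ℕ ↦ ∫ ξ, ‖(Metric.closedBall (0 : Space d) n)ᶜ.indicator f ξ‖ ^ 2)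
      atTop (𝓝 (∫ _ : Space d, (0 : ℝ))) := by
    refine tendsto_integral_of_dominated_convergence (fun ξ ↦ ‖f ξ‖ ^ 2) (fun n ↦ ?_)
      (integrable_norm_sq (Lp.memLp f)) (fun n ↦ Eventually.of_forall fun ξ ↦ ?_)
      (Eventually.of_forall fun ξ ↦ ?_)
    · exact ((Lp.aestronglyMeasurable f).indicator
        Metric.isClosed_closedBall.measurableSet.compl).norm.pow 2
    · rw [Real.norm_eq_abs, abs_of_nonneg (by positivity)]
      gcongr
      exact norm_indicator_le_norm_self _ _
    · refine tendsto_const_nhds.congr' ?_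
      filter_upwards [eventually_ge_atTop ⌈‖ξ‖⌉₊] with n hn
      rw [indicator_of_notMem]
      · simp
      · simpa using Nat.ceil_le.1 hn
  rw [integral_zero] at h2
  have h3 := (h2.congr fun n ↦ (h1 n).symm).sqrt
  simpa using h3

/-! ### Operators on tuples and the coefficient operator -/

/-- Tuples of square integrable functions. -/
abbrev VecL2 (d d₁ : ℕ) : Type := PiLp 2 (fun _ : Fin d₁ ↦ L2 d)

section Vector

variable {d d₁ : ℕ}

/-- The operator on tuples with the given components. -/
def ofComponents (S : Fin d₁ → VecL2 d d₁ →L[ℂ] L2 d) : VecL2 d d₁ →L[ℂ] VecL2 d d₁ :=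
  (PiLp.continuousLinearEquiv 2 ℂ (fun _ : Fin d₁ ↦ L2 d)).symm.toContinuousLinearMap ∘L
    ContinuousLinearMap.pi S

theorem ofComponents_apply (S : Fin d₁ → VecL2 d d₁ →L[ℂ] L2 d) (x : VecL2 d d₁) (k : Fin d₁) :
    ofComponents S x k = S k x := rfl

/-- Componentwise multiplication by a symbol. -/
def BddSymbol.vop (d₁ : ℕ) (m : BddSymbol d) : VecL2 d d₁ →L[ℂ] VecL2 d d₁ :=
  ofComponents fun k ↦ m.op ∘L PiLp.proj 2 (fun _ : Fin d₁ ↦ L2 d) k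

theorem BddSymbol.vop_apply (m : BddSymbol d) (x : VecL2 d d₁) (k : Fin d₁) :
    m.vop d₁ x k = m.op (x k) := rfl

/-- The operator with the single nonzero matrix entry `S`. -/
def entryOp (k r : Fin d₁) (S : L2 d →L[ℂ] L2 d) : VecL2 d d₁ →L[ℂ] VecL2 d d₁ :=
  ofComponents fun l ↦ if l = k then S ∘L PiLp.proj 2 (fun _ : Fin d₁ ↦ L2 d) r else 0

theorem entryOp_apply (k r l : Fin d₁) (S : L2 d →L[ℂ] L2 d) (x : VecL2 d d₁) :
    entryOp k r S x l = if l = k then S (x r) else 0 := by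
  rw [entryOp, ofComponents_apply]
  split_ifs <;> rfl

/-- The operator `a^{ij} ∂_i ∂_j (1 - Δ)⁻¹` on the Fourier side. -/
def coefOp (A : Fin d → Fin d → Matrix (Fin d₁) (Fin d₁) ℝ) : VecL2 d d₁ →L[ℂ] VecL2 d d₁ :=
  ∑ i, ∑ j, ∑ k, ∑ r, (A i j k r : ℂ) • entryOp k r (hessSymbol i j).op

theorem coefOp_apply (A : Fin d → Fin d → Matrix (Fin d₁) (Fin d₁) ℝ) (x : VecL2 d d₁)
    (k : Fin d₁) :
    coefOp A x k = ∑ i, ∑ j, ∑ r, (A i j k r : ℂ) • (hessSymbol i j).op (x r) := by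
  simp only [coefOp, sum_apply, smul_apply, WithLp.ofLp_sum, Finset.sum_apply,
    WithLp.ofLp_smul, Pi.smul_apply, entryOp_apply, smul_ite, smul_zero]
  refine Finset.sum_congr rfl fun i _ ↦ Finset.sum_congr rfl fun j _ ↦ ?_
  rw [Finset.sum_comm]
  simp

/-- Independence of the coefficients from `x` enters here: `coefOp` is a matrix of multipliers with
constant scalar factors, so it commutes with every componentwise multiplier. -/
theorem coefOp_vop (A : Fin d → Fin d → Matrix (Fin d₁) (Fin d₁) ℝ) (m : BddSymbol d)
    (x : VecL2 d d₁) : coefOp A (m.vop d₁ x) = m.vop d₁ (coefOp A x) := by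
  ext k : 1
  rw [coefOp_apply, BddSymbol.vop_apply, coefOp_apply]
  simp only [map_sum, map_smul, BddSymbol.vop_apply]
  simp_rw [BddSymbol.op_comm m]

theorem BddSymbol.vop_vop_eq {m₁ m₂ m₃ m₄ : BddSymbol d} (h : ∀ ξ, m₁ ξ * m₂ ξ = m₃ ξ * m₄ ξ)
    (x : VecL2 d d₁) : m₁.vop d₁ (m₂.vop d₁ x) = m₃.vop d₁ (m₄.vop d₁ x) := by
  ext k : 1
  exact BddSymbol.op_op_eq h (x k)

theorem BddSymbol.vop_vop {m₁ m₂ m₃ : BddSymbol d} (h : ∀ ξ, m₁ ξ * m₂ ξ = m₃ ξ)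
    (x : VecL2 d d₁) : m₁.vop d₁ (m₂.vop d₁ x) = m₃.vop d₁ x := by
  ext k : 1
  exact BddSymbol.op_op _ _ _ h (x k)

theorem norm_sq_vec (x : VecL2 d d₁) : ‖x‖ ^ 2 = ∑ k, ‖x k‖ ^ 2 :=
  PiLp.norm_sq_eq_of_L2 _ x

theorem norm_le_of_components {x y : VecL2 d d₁} (h : ∀ k, ‖x k‖ ≤ ‖y k‖) : ‖x‖ ≤ ‖y‖ := by
  refine le_of_sq_le_sq ?_ (norm_nonneg _)
  rw [norm_sq_vec, norm_sq_vec]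
  gcongr with k
  exact h k

theorem BddSymbol.norm_vop_le_self {m : BddSymbol d} (h : ∀ ξ, |m ξ| ≤ 1) (x : VecL2 d d₁) :
    ‖m.vop d₁ x‖ ≤ ‖x‖ :=
  norm_le_of_components fun k ↦ BddSymbol.norm_op_le_self h (x k)

theorem BddSymbol.norm_vop_le {m₁ m₂ : BddSymbol d} (h : ∀ ξ, |m₁ ξ| ≤ |m₂ ξ|)
    (x : VecL2 d d₁) : ‖m₁.vop d₁ x‖ ≤ ‖m₂.vop d₁ x‖ :=
  norm_le_of_components fun k ↦ BddSymbol.norm_op_le h (x k)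

theorem BddSymbol.inner_vop_left (m : BddSymbol d) (x y : VecL2 d d₁) :
    inner ℂ (m.vop d₁ x) y = inner ℂ x (m.vop d₁ y) := by
  rw [PiLp.inner_apply, PiLp.inner_apply]
  exact Finset.sum_congr rfl fun k _ ↦ BddSymbol.inner_op_left m (x k) (y k)

/-- Only the product needs to be at most `1`. Applied to `gradCutoff` and a Bessel weight, it gives
a bound uniform in the cutoff radius, although `gradCutoff` alone has none. -/
theorem BddSymbol.norm_vop_vop_le {m₁ m₂ : BddSymbol d} (h : ∀ ξ, |m₁ ξ * m₂ ξ| ≤ 1)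
    (x : VecL2 d d₁) : ‖m₁.vop d₁ (m₂.vop d₁ x)‖ ≤ ‖x‖ := by
  let m₃ : BddSymbol d := ⟨fun ξ ↦ m₁ ξ * m₂ ξ, m₁.measurable.mul m₂.measurable, ⟨1, h⟩,
    fun ξ ↦ by rw [m₁.even, m₂.even]⟩
  rw [BddSymbol.vop_vop (m₃ := m₃) fun _ ↦ rfl]
  exact BddSymbol.norm_vop_le_self h x

theorem tendsto_cutoff_vop (x : VecL2 d d₁) :
    Tendsto (fun n ↦ (cutoff d n).vop d₁ x) atTop (𝓝 x) := by
  have h : Tendsto (fun n k ↦ (cutoff d n).op (x k)) atTop (𝓝 fun k ↦ x k) :=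
    tendsto_pi_nhds.2 fun k ↦ tendsto_cutoff_op (x k)
  exact ((PiLp.continuousLinearEquiv 2 ℂ (fun _ : Fin d₁ ↦ L2 d)).symm.continuous.tendsto _).comp h

/-! ### Ellipticity as a dissipation inequality -/

/-- Ellipticity of the coefficients at a fixed time. -/
def EllipticAt (δ : ℝ) (A : Fin d → Fin d → Matrix (Fin d₁) (Fin d₁) ℝ) : Prop :=
  ∀ ξ : Matrix (Fin d₁) (Fin d) ℝ,
    δ * ∑ k, ∑ i, ξ k i ^ 2 ≤ ∑ i, ∑ j, ∑ k, ∑ r, ξ k i * A i j k r * ξ r j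

/-- Ellipticity is applied to the rank-one matrices `Re z ⊗ ξ` and `Im z ⊗ ξ`, and the results are
added: `Re z_k Re z_r + Im z_k Im z_r` is the real part of `z_k` times the conjugate of `z_r`. -/
theorem EllipticAt.complex_le {δ : ℝ} {A : Fin d → Fin d → Matrix (Fin d₁) (Fin d₁) ℝ}
    (hA : EllipticAt δ A) (ξ : Space d) (z : Fin d₁ → ℂ) :
    δ * (‖ξ‖ ^ 2 * ∑ k, ‖z k‖ ^ 2) ≤
      ∑ i, ∑ j, ∑ k, ∑ r, A i j k r * (ξ i * ξ j * (z k * (starRingEnd ℂ) (z r)).re) := by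
  have h1 := hA (Matrix.of fun k i ↦ (z k).re * ξ i)
  have h2 := hA (Matrix.of fun k i ↦ (z k).im * ξ i)
  have h3 := add_le_add h1 h2
  refine (le_of_eq ?_).trans (h3.trans (le_of_eq ?_))
  · rw [← mul_add, ← Finset.sum_add_distrib, EuclideanSpace.real_norm_sq_eq, Finset.mul_sum]
    congr 1
    refine Finset.sum_congr rfl fun k _ ↦ ?_
    rw [← Finset.sum_add_distrib, Finset.sum_mul]
    refine Finset.sum_congr rfl fun i _ ↦ ?_
    rw [← Complex.normSq_eq_norm_sq, Complex.normSq_apply]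
    simp only [Matrix.of_apply]
    ring
  · simp only [← Finset.sum_add_distrib]
    refine Finset.sum_congr rfl fun i _ ↦ Finset.sum_congr rfl fun j _ ↦
      Finset.sum_congr rfl fun k _ ↦ Finset.sum_congr rfl fun r _ ↦ ?_
    simp only [Matrix.of_apply, Complex.mul_re, Complex.conj_re, Complex.conj_im]
    ring

end Vector

section

variable {d d₁ : ℕ}

theorem BddSymbol.integrable_re_mul (m₁ m₂ : BddSymbol d) (f g : L2 d) :
    Integrable fun ξ ↦ m₁ ξ * m₂ ξ * (g ξ * (starRingEnd ℂ) (f ξ)).re := by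
  refine (L2.integrable_inner (𝕜 := ℂ) (m₁.op f) (m₂.op g)).re.congr ?_
  filter_upwards [m₁.coeFn_op f, m₂.coeFn_op g] with ξ h1 h2
  rw [h1, h2]
  simp
  ring

theorem BddSymbol.re_inner_op_op (m₁ m₂ : BddSymbol d) (f g : L2 d) :
    (inner ℂ (m₁.op f) (m₂.op g)).re =
      ∫ ξ, m₁ ξ * m₂ ξ * (g ξ * (starRingEnd ℂ) (f ξ)).re := by
  rw [L2.inner_def]
  refine (integral_re (L2.integrable_inner (𝕜 := ℂ) (m₁.op f) (m₂.op g))).symm.trans ?_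
  refine integral_congr_ae ?_
  filter_upwards [m₁.coeFn_op f, m₂.coeFn_op g] with ξ h1 h2
  rw [h1, h2]
  simp
  ring

/-- The inequality holds under the integral at each frequency: `EllipticAt.complex_le` is multiplied
by a nonnegative factor, and the minus sign in `hessSymbol` reverses it. Keeping the weight `w` free
serves both energy estimates. -/
theorem EllipticAt.re_inner_coefOp_le {δ : ℝ}
    {A : Fin d → Fin d → Matrix (Fin d₁) (Fin d₁) ℝ} (hA : EllipticAt δ A) {w : BddSymbol d}
    (hw : ∀ ξ, 0 ≤ w ξ) (x : VecL2 d d₁) :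
    (inner ℂ (coefOp A x) (w.vop d₁ x)).re ≤
      -δ * (inner ℂ ((lapSymbol d).vop d₁ x) (w.vop d₁ x)).re := by
  have hint : ∀ i j k r, Integrable fun ξ ↦
      A i j k r * (hessSymbol i j ξ * w ξ * ((x k) ξ * (starRingEnd ℂ) ((x r) ξ)).re) :=
    fun i j k r ↦ (BddSymbol.integrable_re_mul _ _ _ _).const_mul _
  have h1 : (inner ℂ (coefOp A x) (w.vop d₁ x)).re = ∫ ξ, ∑ i, ∑ j, ∑ k, ∑ r,
      A i j k r * (hessSymbol i j ξ * w ξ * ((x k) ξ * (starRingEnd ℂ) ((x r) ξ)).re) := by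
    rw [integral_finsetSum _ fun i _ ↦ integrable_finsetSum _ fun j _ ↦
      integrable_finsetSum _ fun k _ ↦ integrable_finsetSum _ fun r _ ↦ hint i j k r]
    have h2 : ∀ k, (inner ℂ (coefOp A x k) (w.vop d₁ x k)).re =
        ∑ i, ∑ j, ∑ r, A i j k r * (inner ℂ ((hessSymbol i j).op (x r)) (w.op (x k))).re := by
      intro k
      rw [coefOp_apply, BddSymbol.vop_apply]
      simp only [sum_inner, inner_smul_left, Complex.conj_ofReal, Complex.re_sum,
        Complex.re_ofReal_mul]
    rw [PiLp.inner_apply, Complex.re_sum, Finset.sum_congr rfl fun k _ ↦ h2 k, Finset.sum_comm]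
    refine Finset.sum_congr rfl fun i _ ↦ ?_
    rw [Finset.sum_comm, integral_finsetSum _ fun j _ ↦
      integrable_finsetSum _ fun k _ ↦ integrable_finsetSum _ fun r _ ↦ hint i j k r]
    refine Finset.sum_congr rfl fun j _ ↦ ?_
    rw [integral_finsetSum _ fun k _ ↦ integrable_finsetSum _ fun r _ ↦ hint i j k r]
    refine Finset.sum_congr rfl fun k _ ↦ ?_
    rw [integral_finsetSum _ fun r _ ↦ hint i j k r]
    refine Finset.sum_congr rfl fun r _ ↦ ?_
    rw [integral_const_mul, BddSymbol.re_inner_op_op]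
  have hint' : ∀ k, Integrable fun ξ ↦
      lapSymbol d ξ * w ξ * ((x k) ξ * (starRingEnd ℂ) ((x k) ξ)).re :=
    fun k ↦ BddSymbol.integrable_re_mul _ _ _ _
  have h3 : (inner ℂ ((lapSymbol d).vop d₁ x) (w.vop d₁ x)).re = ∫ ξ, ∑ k,
      lapSymbol d ξ * w ξ * ((x k) ξ * (starRingEnd ℂ) ((x k) ξ)).re := by
    rw [integral_finsetSum _ fun k _ ↦ hint' k, PiLp.inner_apply, Complex.re_sum]
    exact Finset.sum_congr rfl fun k _ ↦ BddSymbol.re_inner_op_op _ _ _ _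
  rw [h1, h3, ← integral_const_mul]
  refine integral_mono (integrable_finsetSum _ fun i _ ↦ integrable_finsetSum _ fun j _ ↦
      integrable_finsetSum _ fun k _ ↦ integrable_finsetSum _ fun r _ ↦ hint i j k r)
    ((integrable_finsetSum _ fun k _ ↦ hint' k).const_mul _) fun ξ ↦ ?_
  have h4 := hA.complex_le ξ fun k ↦ (x k) ξ
  have h5 : 0 ≤ (2 * Real.pi) ^ 2 * besselSymbol d (-2) ξ * w ξ :=
    mul_nonneg (mul_nonneg (sq_nonneg _) (besselSymbol_pos _ _).le) (hw ξ)
  have h6 := mul_le_mul_of_nonneg_left h4 h5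
  have h7 : ∑ i, ∑ j, ∑ k, ∑ r,
      A i j k r * (hessSymbol i j ξ * w ξ * ((x k) ξ * (starRingEnd ℂ) ((x r) ξ)).re) =
      -((2 * Real.pi) ^ 2 * besselSymbol d (-2) ξ * w ξ * ∑ i, ∑ j, ∑ k, ∑ r,
        A i j k r * (ξ i * ξ j * ((x k) ξ * (starRingEnd ℂ) ((x r) ξ)).re)) := by
    simp only [Finset.mul_sum, ← Finset.sum_neg_distrib]
    refine Finset.sum_congr rfl fun i _ ↦ Finset.sum_congr rfl fun j _ ↦
      Finset.sum_congr rfl fun k _ ↦ Finset.sum_congr rfl fun r _ ↦ ?_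
    simp only [hessSymbol]
    ring
  have h8 : -δ * ∑ k, lapSymbol d ξ * w ξ * ((x k) ξ * (starRingEnd ℂ) ((x k) ξ)).re =
      -((2 * Real.pi) ^ 2 * besselSymbol d (-2) ξ * w ξ *
        (δ * (‖ξ‖ ^ 2 * ∑ k, ‖(x k) ξ‖ ^ 2))) := by
    simp only [Finset.mul_sum, ← Finset.sum_neg_distrib]
    refine Finset.sum_congr rfl fun k _ ↦ ?_
    rw [Complex.mul_conj, Complex.ofReal_re, Complex.normSq_eq_norm_sq]
    simp only [lapSymbol]
    ring
  simp only
  rw [h7, h8]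
  linarith

/-! ### The integrated equation on the Fourier side -/

/-- Measurability, boundedness and ellipticity of the coefficients on `(0,T]`. -/
structure Admissible (δ T : ℝ) (a : Coeff d d₁) : Prop where
  aemeasurable : ∀ i j k r, AEMeasurable (fun t ↦ a t i j k r) (volume.restrict (Ioc 0 T))
  bounded : ∃ M : ℝ, ∀ t ∈ Ioc 0 T, ∀ i j, matNorm (a t i j) ≤ M
  elliptic : ∀ t ∈ Ioc 0 T, EllipticAt δ (a t)

theorem abs_le_matNorm (C : Matrix (Fin d₁) (Fin d₁) ℝ) (k r : Fin d₁) : |C k r| ≤ matNorm C := by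
  refine Real.abs_le_sqrt ?_
  have h1 := Finset.single_le_sum (f := fun r ↦ C k r ^ 2) (fun _ _ ↦ sq_nonneg _)
    (Finset.mem_univ r)
  have h2 := Finset.single_le_sum (f := fun k ↦ ∑ r, C k r ^ 2)
    (fun _ _ ↦ Finset.sum_nonneg fun _ _ ↦ sq_nonneg _) (Finset.mem_univ k)
  exact h1.trans h2

namespace Admissible

variable {δ T : ℝ} {a : Coeff d d₁}

theorem aestronglyMeasurable_coefOp (ha : Admissible δ T a) :
    AEStronglyMeasurable (fun t ↦ coefOp (a t)) (volume.restrict (Ioc 0 T)) := by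
  unfold coefOp
  refine Finset.aestronglyMeasurable_fun_sum _ fun i _ ↦
    Finset.aestronglyMeasurable_fun_sum _ fun j _ ↦
    Finset.aestronglyMeasurable_fun_sum _ fun k _ ↦
    Finset.aestronglyMeasurable_fun_sum _ fun r _ ↦ ?_
  exact (Complex.measurable_ofReal.comp_aemeasurable
    (ha.aemeasurable i j k r)).aestronglyMeasurable.smul_const _

theorem exists_norm_coefOp_le (ha : Admissible δ T a) :
    ∃ C, 0 ≤ C ∧ ∀ t ∈ Ioc 0 T, ‖coefOp (a t)‖ ≤ C := by
  obtain ⟨M, hM⟩ := ha.bounded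
  refine ⟨∑ i : Fin d, ∑ j : Fin d, ∑ k : Fin d₁, ∑ r : Fin d₁,
    |M| * ‖entryOp k r (hessSymbol i j).op‖, by positivity, fun t ht ↦ ?_⟩
  unfold coefOp
  refine (norm_sum_le _ _).trans (Finset.sum_le_sum fun i _ ↦ ?_)
  refine (norm_sum_le _ _).trans (Finset.sum_le_sum fun j _ ↦ ?_)
  refine (norm_sum_le _ _).trans (Finset.sum_le_sum fun k _ ↦ ?_)
  refine (norm_sum_le _ _).trans (Finset.sum_le_sum fun r _ ↦ ?_)
  rw [norm_smul, Complex.norm_real]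
  gcongr
  exact (abs_le_matNorm _ _ _).trans ((hM t ht i j).trans (le_abs_self M))

theorem memLp_coefOp (ha : Admissible δ T a) {U : ℝ → VecL2 d d₁}
    (hU : MemLp U 2 (volume.restrict (Ioc 0 T))) :
    MemLp (fun t ↦ coefOp (a t) (U t)) 2 (volume.restrict (Ioc 0 T)) := by
  obtain ⟨C, -, hC⟩ := ha.exists_norm_coefOp_le
  have h := memLp_top_of_bound ha.aestronglyMeasurable_coefOp C
    (by filter_upwards [ae_restrict_mem measurableSet_Ioc] with t ht using hC t ht)
  exact (ContinuousLinearMap.apply ℂ (VecL2 d d₁)).flip.memLp_of_bilin 2 h hU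

end Admissible

/-- The right-hand side of the integrated equation on the Fourier side. -/
def trajectory (a : Coeff d d₁) (F : ℝ → VecL2 d d₁) (U₀ : VecL2 d d₁) (U : ℝ → VecL2 d d₁)
    (t : ℝ) : VecL2 d d₁ :=
  (negBessel d (-1) (by norm_num)).vop d₁ U₀ +
    ∫ τ in (0 : ℝ)..t, (coefOp (a τ) (U τ) + F τ)

/-- The system on the Fourier side: `U`, `F`, `U₀` represent elements of `H^{γ+2}_2`, `H^γ_2`,
`H^{γ+1}_2`. -/
def IsMild (T : ℝ) (a : Coeff d d₁) (F : ℝ → VecL2 d d₁) (U₀ : VecL2 d d₁)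
    (U : ℝ → VecL2 d d₁) : Prop :=
  MemLp U 2 (volume.restrict (Ioc 0 T)) ∧ ∀ᵐ t ∂(volume.restrict (Ioc 0 T)),
    (negBessel d (-2) (by norm_num)).vop d₁ (U t) = trajectory a F U₀ U t

theorem intervalIntegrable_of_memLp_two {X : Type*} [NormedAddCommGroup X] {T : ℝ} (hT : 0 ≤ T)
    {f : ℝ → X} (hf : MemLp f 2 (volume.restrict (Ioc 0 T))) : IntervalIntegrable f volume 0 T := by
  rw [intervalIntegrable_iff_integrableOn_Ioc_of_le hT]
  exact hf.integrable (by norm_num)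

theorem integrable_re_inner {α E : Type*} [MeasurableSpace α] {μ : Measure α}
    [NormedAddCommGroup E] [InnerProductSpace ℂ E] {f g : α → E} (hf : MemLp f 2 μ)
    (hg : MemLp g 2 μ) : Integrable (fun x ↦ (inner ℂ (f x) (g x)).re) μ := by
  refine (hf.norm.integrable_mul hg.norm).mono'
    (Complex.continuous_re.comp_aestronglyMeasurable (hf.1.inner hg.1))
    (Eventually.of_forall fun x ↦ ?_)
  exact (Complex.abs_re_le_norm _).trans (norm_inner_le_norm _ _)

end

/-! ### Energy estimates -/

section

variable {d d₁ : ℕ} {δ T : ℝ} {a : Coeff d d₁} {F : ℝ → VecL2 d d₁} {U₀ : VecL2 d d₁}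
  {U : ℝ → VecL2 d d₁}

theorem negBessel_norm_vop_le {s : ℝ} (hs : s ≤ 0) (x : VecL2 d d₁) :
    ‖(negBessel d s hs).vop d₁ x‖ ≤ ‖x‖ :=
  BddSymbol.norm_vop_le_self (fun ξ ↦ by
    change |besselSymbol d s ξ| ≤ 1
    rw [abs_of_pos (besselSymbol_pos _ _)]; exact besselSymbol_le_one hs ξ) x

theorem lapSymbol_nonneg (ξ : Space d) : 0 ≤ lapSymbol d ξ :=
  mul_nonneg (sq_nonneg _) (besselSymbol_pos _ _).le

/-- The identity `-Δ(1-Δ)⁻¹ + (1-Δ)⁻¹ = 1`, by which second derivatives and the trajectory together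
control the full solution. -/
theorem lapSymbol_add_negBessel (ξ : Space d) :
    lapSymbol d ξ + negBessel d (-2) (by norm_num) ξ = 1 := by
  have h : lapSymbol d ξ + negBessel d (-2) (by norm_num) ξ =
      ((2 * Real.pi * ‖ξ‖) ^ 2 + 1) * besselSymbol d (-2) ξ := by
    simp only [lapSymbol, negBessel]; ring
  rw [h, besselSymbol_neg_two, add_comm]
  exact mul_inv_cancel₀ (besselSymbol_base_pos ξ).ne'

theorem lap_add_negBessel_vop (x : VecL2 d d₁) :
    (lapSymbol d).vop d₁ x + (negBessel d (-2) (by norm_num)).vop d₁ x = x := by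
  ext k : 1
  exact (BddSymbol.op_add_op _ _ (oneSymbol d) lapSymbol_add_negBessel (x k)).trans
    (oneSymbol_op (x k))

theorem re_inner_lap_negBessel_nonneg (x : VecL2 d d₁) :
    0 ≤ (inner ℂ ((lapSymbol d).vop d₁ x) ((negBessel d (-2) (by norm_num)).vop d₁ x)).re := by
  rw [PiLp.inner_apply, Complex.re_sum]
  refine Finset.sum_nonneg fun k _ ↦ ?_
  rw [BddSymbol.vop_apply, BddSymbol.vop_apply, BddSymbol.re_inner_op_op]
  refine integral_nonneg fun ξ ↦ mul_nonneg (mul_nonneg (lapSymbol_nonneg ξ)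
    (besselSymbol_pos _ _).le) ?_
  rw [Complex.mul_conj, Complex.ofReal_re]
  exact Complex.normSq_nonneg _

/-- The weight `(1-Δ)⁻¹`: the elliptic part is dissipative when paired with the trajectory, which
equals `J U` almost everywhere. -/
theorem EllipticAt.re_inner_negBessel_nonpos {A : Fin d → Fin d → Matrix (Fin d₁) (Fin d₁) ℝ}
    (hA : EllipticAt δ A) (hδ : 0 < δ) (x : VecL2 d d₁) :
    (inner ℂ (coefOp A x) ((negBessel d (-2) (by norm_num)).vop d₁ x)).re ≤ 0 := by
  refine (hA.re_inner_coefOp_le (fun ξ ↦ (besselSymbol_pos _ _).le) x).trans ?_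
  nlinarith [re_inner_lap_negBessel_nonneg x]

/-- The weight `-Δ(1-Δ)⁻¹`: the dissipation becomes coercive and controls the second derivatives. -/
theorem EllipticAt.re_inner_lap_le {A : Fin d → Fin d → Matrix (Fin d₁) (Fin d₁) ℝ}
    (hA : EllipticAt δ A) (x : VecL2 d d₁) :
    (inner ℂ (coefOp A x) ((lapSymbol d).vop d₁ x)).re ≤ -δ * ‖(lapSymbol d).vop d₁ x‖ ^ 2 := by
  refine (hA.re_inner_coefOp_le lapSymbol_nonneg x).trans (le_of_eq ?_)
  congr 1
  exact inner_self_eq_norm_sq (𝕜 := ℂ) _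

theorem Admissible.intervalIntegrable (ha : Admissible δ T a) (hT : 0 ≤ T)
    (hF : MemLp F 2 (volume.restrict (Ioc 0 T))) (hU : MemLp U 2 (volume.restrict (Ioc 0 T))) :
    IntervalIntegrable (fun τ ↦ coefOp (a τ) (U τ) + F τ) volume 0 T :=
  intervalIntegrable_of_memLp_two hT ((ha.memLp_coefOp hU).add hF)

theorem uIcc_subset_of_mem {t : ℝ} (ht : t ∈ Icc 0 T) : uIcc 0 t ⊆ uIcc 0 T := by
  rw [uIcc_of_le ht.1, uIcc_of_le (ht.1.trans ht.2)]
  exact Icc_subset_Icc_right ht.2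

theorem Admissible.map_trajectory (ha : Admissible δ T a)
    (hF : MemLp F 2 (volume.restrict (Ioc 0 T))) (hU : MemLp U 2 (volume.restrict (Ioc 0 T)))
    (S : VecL2 d d₁ →L[ℝ] VecL2 d d₁) {t : ℝ} (ht : t ∈ Icc 0 T) :
    S (trajectory a F U₀ U t) = S ((negBessel d (-1) (by norm_num)).vop d₁ U₀) +
      ∫ τ in (0 : ℝ)..t, S (coefOp (a τ) (U τ) + F τ) := by
  rw [trajectory, map_add, S.intervalIntegral_comp_comm
    ((ha.intervalIntegrable (ht.1.trans ht.2) hF hU).mono_set (uIcc_subset_of_mem ht))]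

/-- The operator `S` selects the norm in which energy is measured: the identity for the trajectory
bound, a cut-off gradient for the bound on second derivatives. -/
theorem Admissible.energy (ha : Admissible δ T a)
    (hF : MemLp F 2 (volume.restrict (Ioc 0 T))) (hU : MemLp U 2 (volume.restrict (Ioc 0 T)))
    (S : VecL2 d d₁ →L[ℂ] VecL2 d d₁) {t : ℝ} (ht : t ∈ Icc 0 T) :
    ‖S (trajectory a F U₀ U t)‖ ^ 2 = ‖S ((negBessel d (-1) (by norm_num)).vop d₁ U₀)‖ ^ 2 +
      2 * ∫ τ in (0 : ℝ)..t,
        (inner ℂ (S (trajectory a F U₀ U τ)) (S (coefOp (a τ) (U τ) + F τ))).re := by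
  have h := intervalIntegrable_of_memLp_two (ht.1.trans ht.2)
    (((ha.memLp_coefOp hU).add hF).continuousLinearMap_comp S)
  exact norm_sq_primitive_eq (y := fun t ↦ S (trajectory a F U₀ U t)) h
    (fun t ht ↦ ha.map_trajectory hF hU (S.restrictScalars ℝ) ht) ht

theorem ae_uIoc_of_ae_restrict {p : ℝ → Prop} (h : ∀ᵐ t ∂(volume.restrict (Ioc 0 T)), p t)
    {t : ℝ} (ht : t ∈ Icc 0 T) : ∀ᵐ τ ∂(volume.restrict (Ioc 0 t)), p τ :=
  ae_mono (Measure.restrict_mono (Ioc_subset_Ioc_right ht.2) le_rfl) h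

theorem memLp_mono_right {X : Type*} [NormedAddCommGroup X] {f : ℝ → X}
    (hf : MemLp f 2 (volume.restrict (Ioc 0 T))) {t : ℝ} (ht : t ∈ Icc 0 T) :
    MemLp f 2 (volume.restrict (Ioc 0 t)) :=
  hf.mono_measure (Measure.restrict_mono (Ioc_subset_Ioc_right ht.2) le_rfl)

/-- The energy estimate for the trajectory itself. -/
theorem IsMild.norm_trajectory_sq_le (ha : Admissible δ T a) (hδ : 0 < δ) (hT : 0 < T)
    (hF : MemLp F 2 (volume.restrict (Ioc 0 T))) (h : IsMild T a F U₀ U) {t : ℝ}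
    (ht : t ∈ Icc 0 T) :
    ‖trajectory a F U₀ U t‖ ^ 2 ≤ 2 * ‖U₀‖ ^ 2 + 4 * T * ∫ τ in Ioc 0 T, ‖F τ‖ ^ 2 := by
  obtain ⟨hU, hae⟩ := h
  have hJU : MemLp (fun t ↦ (negBessel d (-2) (by norm_num)).vop d₁ (U t)) 2
      (volume.restrict (Ioc 0 T)) := hU.continuousLinearMap_comp _
  have hy : MemLp (trajectory a F U₀ U) 2 (volume.restrict (Ioc 0 T)) := hJU.ae_eq hae
  have hh := (ha.memLp_coefOp hU).add hF
  set E := ∫ τ in Ioc 0 T, ‖trajectory a F U₀ U τ‖ ^ 2 with hE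
  set Φ := ∫ τ in Ioc 0 T, ‖F τ‖ ^ 2 with hΦ
  -- Young's inequality with parameter `2 * T` is chosen so that integrating this bound over `(0,T]`
  -- returns only half of `E`, which can be absorbed without Gronwall's lemma.
  have key : ∀ t ∈ Icc 0 T, ‖trajectory a F U₀ U t‖ ^ 2 ≤
      ‖U₀‖ ^ 2 + ((2 * T)⁻¹ * E + 2 * T * Φ) := by
    intro t ht
    have h1 := ha.energy (U₀ := U₀) hF hU (ContinuousLinearMap.id ℂ _) ht
    simp only [ContinuousLinearMap.id_apply] at h1
    rw [h1]
    refine add_le_add (pow_le_pow_left₀ (norm_nonneg _) (negBessel_norm_vop_le _ _) 2) ?_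
    rw [intervalIntegral.integral_of_le ht.1, ← integral_const_mul]
    have hb : Integrable (fun τ ↦ (2 * T)⁻¹ * ‖trajectory a F U₀ U τ‖ ^ 2 + 2 * T * ‖F τ‖ ^ 2)
        (volume.restrict (Ioc 0 T)) :=
      ((integrable_norm_sq hy).const_mul _).add ((integrable_norm_sq hF).const_mul _)
    calc _ ≤ ∫ τ in Ioc 0 t,
          ((2 * T)⁻¹ * ‖trajectory a F U₀ U τ‖ ^ 2 + 2 * T * ‖F τ‖ ^ 2) := by
          refine integral_mono_ae ((integrable_re_inner (memLp_mono_right hy ht)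
            (memLp_mono_right hh ht)).const_mul 2)
            (hb.mono_measure (Measure.restrict_mono (Ioc_subset_Ioc_right ht.2) le_rfl)) ?_
          filter_upwards [ae_uIoc_of_ae_restrict hae ht, ae_restrict_mem measurableSet_Ioc]
            with τ hτ hτt
          have hell := ha.elliptic τ ⟨hτt.1, hτt.2.trans ht.2⟩
          have h2 := hell.re_inner_negBessel_nonpos hδ (U τ)
          rw [hτ] at h2
          have h3 := inner_re_symm (𝕜 := ℂ) (coefOp (a τ) (U τ)) (trajectory a F U₀ U τ)
          simp only [RCLike.re_to_complex] at h3
          rw [h3] at h2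
          have h4 := (Complex.re_le_norm _).trans
            (norm_inner_le_norm (𝕜 := ℂ) (trajectory a F U₀ U τ) (F τ))
          have h5 : 2 * (‖trajectory a F U₀ U τ‖ * ‖F τ‖) ≤
              (2 * T)⁻¹ * ‖trajectory a F U₀ U τ‖ ^ 2 + 2 * T * ‖F τ‖ ^ 2 := by
            have h6 := mul_nonneg (by positivity : 0 ≤ (2 * T)⁻¹)
              (sq_nonneg (‖trajectory a F U₀ U τ‖ - 2 * T * ‖F τ‖))
            have h7 : (2 * T)⁻¹ * (‖trajectory a F U₀ U τ‖ - 2 * T * ‖F τ‖) ^ 2 =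
              (2 * T)⁻¹ * ‖trajectory a F U₀ U τ‖ ^ 2 + 2 * T * ‖F τ‖ ^ 2 -
                2 * (‖trajectory a F U₀ U τ‖ * ‖F τ‖) := by
              field_simp
              ring
            linarith
          simp only [inner_add_right, Complex.add_re]
          linarith
      _ ≤ ∫ τ in Ioc 0 T,
          ((2 * T)⁻¹ * ‖trajectory a F U₀ U τ‖ ^ 2 + 2 * T * ‖F τ‖ ^ 2) :=
          setIntegral_mono_set hb (Eventually.of_forall fun τ ↦ by positivity)
            (Ioc_subset_Ioc_right ht.2).eventuallyLE
      _ = _ := by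
          rw [integral_add ((integrable_norm_sq hy).const_mul _)
            ((integrable_norm_sq hF).const_mul _), integral_const_mul, integral_const_mul]
  have hE2 : E ≤ T * (‖U₀‖ ^ 2 + ((2 * T)⁻¹ * E + 2 * T * Φ)) := by
    calc E ≤ ∫ _ in Ioc 0 T, (‖U₀‖ ^ 2 + ((2 * T)⁻¹ * E + 2 * T * Φ)) := by
          refine setIntegral_mono_on (integrable_norm_sq hy) (by simp) measurableSet_Ioc
            fun τ hτ ↦ key τ (Ioc_subset_Icc_self hτ)
      _ = _ := by simp [hT.le]
  have h8 : T * (‖U₀‖ ^ 2 + ((2 * T)⁻¹ * E + 2 * T * Φ)) =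
      T * ‖U₀‖ ^ 2 + E / 2 + 2 * T ^ 2 * Φ := by
    field_simp
    ring
  have h9 : (2 * T)⁻¹ * E ≤ ‖U₀‖ ^ 2 + 2 * T * Φ := by
    rw [inv_mul_le_iff₀ (by positivity)]
    nlinarith
  linarith [key t ht]

theorem IsMild.integral_trajectory_sq_le (ha : Admissible δ T a) (hδ : 0 < δ) (hT : 0 < T)
    (hF : MemLp F 2 (volume.restrict (Ioc 0 T))) (h : IsMild T a F U₀ U) :
    ∫ τ in Ioc 0 T, ‖(negBessel d (-2) (by norm_num)).vop d₁ (U τ)‖ ^ 2 ≤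
      T * (2 * ‖U₀‖ ^ 2 + 4 * T * ∫ τ in Ioc 0 T, ‖F τ‖ ^ 2) := by
  calc _ ≤ ∫ _ in Ioc 0 T, (2 * ‖U₀‖ ^ 2 + 4 * T * ∫ τ in Ioc 0 T, ‖F τ‖ ^ 2) := by
        refine integral_mono_ae (integrable_norm_sq (h.1.continuousLinearMap_comp _)) (by simp) ?_
        filter_upwards [h.2, ae_restrict_mem measurableSet_Ioc] with τ h1 h2
        rw [h1]
        exact h.norm_trajectory_sq_le ha hδ hT hF (Ioc_subset_Icc_self h2)
    _ = _ := by simp [hT.le]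

/-- The energy estimate for the second derivatives of frequency-localised solutions. -/
theorem IsMild.integral_lap_sq_le (ha : Admissible δ T a) (hδ : 0 < δ) (hT : 0 < T)
    (hF : MemLp F 2 (volume.restrict (Ioc 0 T))) (h : IsMild T a F U₀ U) {n : ℕ}
    (hn : ∀ᵐ t ∂(volume.restrict (Ioc 0 T)), (cutoff d n).vop d₁ (U t) = U t) :
    ∫ τ in Ioc 0 T, ‖(lapSymbol d).vop d₁ (U τ)‖ ^ 2 ≤
      δ⁻¹ * ‖U₀‖ ^ 2 + δ⁻¹ ^ 2 * ∫ τ in Ioc 0 T, ‖F τ‖ ^ 2 := by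
  obtain ⟨hU, hae⟩ := h
  have hRU : MemLp (fun t ↦ (lapSymbol d).vop d₁ (U t)) 2 (volume.restrict (Ioc 0 T)) :=
    hU.continuousLinearMap_comp _
  have hh := (ha.memLp_coefOp hU).add hF
  set Φ := ∫ τ in Ioc 0 T, ‖F τ‖ ^ 2 with hΦ
  -- Testing against `-Δ` means measuring the energy of the gradient; the cutoff makes the gradient
  -- multiplier bounded.
  set S := (gradCutoff d n).vop d₁ with hS
  have h1 := ha.energy (U₀ := U₀) hF hU S (right_mem_Icc.2 hT.le)
  -- Since `(2π|ξ|)² ≤ 1 + (2π|ξ|)²`, half an order of `(1-Δ)⁻¹` pays for the gradient, uniformly in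
  -- `n`. This is why the initial value is needed only in `H^{γ+1}_2`.
  have h2 : ‖S ((negBessel d (-1) (by norm_num)).vop d₁ U₀)‖ ≤ ‖U₀‖ := by
    refine BddSymbol.norm_vop_vop_le (fun ξ ↦ ?_) U₀
    by_cases hξ : ξ ∈ Metric.closedBall (0 : Space d) n
    · simp only [gradCutoff, negBessel, indicator_of_mem hξ]
      rw [abs_of_nonneg (mul_nonneg (by positivity) (besselSymbol_pos _ _).le)]
      refine le_of_sq_le_sq ?_ zero_le_one
      have h3 : besselSymbol d (-1) ξ ^ 2 = besselSymbol d (-2) ξ := by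
        rw [sq, besselSymbol_mul]; norm_num
      rw [mul_pow, h3, besselSymbol_neg_two, ← div_eq_mul_inv, one_pow,
        div_le_one (besselSymbol_base_pos ξ)]
      linarith
    · simp [gradCutoff, indicator_of_notMem hξ]
  have h3 : ∫ τ in (0 : ℝ)..T, (inner ℂ (S (trajectory a F U₀ U τ))
      (S (coefOp (a τ) (U τ) + F τ))).re ≤
      ∫ τ in Ioc 0 T, (-(δ / 2) * ‖(lapSymbol d).vop d₁ (U τ)‖ ^ 2 + (2 * δ)⁻¹ * ‖F τ‖ ^ 2) := by
    rw [intervalIntegral.integral_of_le hT.le]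
    -- With both copies of `S` moved onto `J U`, the symbol is `(2π|ξ|)²(1+|2πξ|²)⁻¹` times the
    -- cutoff, and the cutoff acts trivially on `U`.
    have h4 : ∀ᵐ τ ∂(volume.restrict (Ioc 0 T)), (inner ℂ (S (trajectory a F U₀ U τ))
        (S (coefOp (a τ) (U τ) + F τ))).re =
        (inner ℂ ((lapSymbol d).vop d₁ (U τ)) (coefOp (a τ) (U τ) + F τ)).re := by
      filter_upwards [hae, hn] with τ h5 h6
      rw [← h5, ← BddSymbol.inner_vop_left]
      have h7 : ∀ ξ, gradCutoff d n ξ * (gradCutoff d n ξ * besselSymbol d (-2) ξ) =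
          lapSymbol d ξ * cutoff d n ξ := by
        intro ξ
        by_cases hξ : ξ ∈ Metric.closedBall (0 : Space d) n
        · simp only [gradCutoff, cutoff, lapSymbol, indicator_of_mem hξ, Pi.one_apply]; ring
        · simp [gradCutoff, cutoff, indicator_of_notMem hξ]
      let m : BddSymbol d := ⟨fun ξ ↦ gradCutoff d n ξ * besselSymbol d (-2) ξ,
        (gradCutoff d n).measurable.mul (measurable_besselSymbol _), by
          obtain ⟨C, hC⟩ := (gradCutoff d n).bound
          refine ⟨C, fun ξ ↦ ?_⟩
          rw [abs_mul, abs_of_pos (besselSymbol_pos _ ξ)]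
          exact (mul_le_of_le_one_right (abs_nonneg _)
            (besselSymbol_le_one (by norm_num) ξ)).trans (hC ξ),
        fun ξ ↦ by rw [(gradCutoff d n).even, besselSymbol_neg]⟩
      have h8 : (gradCutoff d n).vop d₁ ((gradCutoff d n).vop d₁
          ((negBessel d (-2) (by norm_num)).vop d₁ (U τ))) = (lapSymbol d).vop d₁ (U τ) := by
        rw [BddSymbol.vop_vop (m₁ := gradCutoff d n) (m₂ := negBessel d (-2) (by norm_num))
            (m₃ := m) fun _ ↦ rfl,
          BddSymbol.vop_vop_eq (m₂ := m) h7, h6]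
      rw [h8]
    rw [integral_congr_ae h4]
    refine integral_mono_ae (integrable_re_inner hRU hh)
      (((integrable_norm_sq hRU).const_mul _).add ((integrable_norm_sq hF).const_mul _)) ?_
    filter_upwards [ae_restrict_mem measurableSet_Ioc] with τ hτ
    have h5 := (ha.elliptic τ hτ).re_inner_lap_le (U τ)
    have h6 := inner_re_symm (𝕜 := ℂ) (coefOp (a τ) (U τ)) ((lapSymbol d).vop d₁ (U τ))
    simp only [RCLike.re_to_complex] at h6
    rw [h6] at h5
    have h7 := (Complex.re_le_norm _).trans
      (norm_inner_le_norm (𝕜 := ℂ) ((lapSymbol d).vop d₁ (U τ)) (F τ))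
    -- The weights in Young's inequality are chosen to use up exactly half of the coercivity `δ`.
    have h8 : ‖(lapSymbol d).vop d₁ (U τ)‖ * ‖F τ‖ ≤
        δ / 2 * ‖(lapSymbol d).vop d₁ (U τ)‖ ^ 2 + (2 * δ)⁻¹ * ‖F τ‖ ^ 2 := by
      have h9 := mul_nonneg (by positivity : 0 ≤ (2 * δ)⁻¹)
        (sq_nonneg (δ * ‖(lapSymbol d).vop d₁ (U τ)‖ - ‖F τ‖))
      have h10 : (2 * δ)⁻¹ * (δ * ‖(lapSymbol d).vop d₁ (U τ)‖ - ‖F τ‖) ^ 2 =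
        δ / 2 * ‖(lapSymbol d).vop d₁ (U τ)‖ ^ 2 + (2 * δ)⁻¹ * ‖F τ‖ ^ 2 -
          ‖(lapSymbol d).vop d₁ (U τ)‖ * ‖F τ‖ := by
        field_simp
        ring
      linarith
    simp only [inner_add_right, Complex.add_re]
    linarith
  rw [integral_add ((integrable_norm_sq hRU).const_mul _) ((integrable_norm_sq hF).const_mul _),
    integral_const_mul, integral_const_mul] at h3
  have h4 : ‖S ((negBessel d (-1) (by norm_num)).vop d₁ U₀)‖ ^ 2 ≤ ‖U₀‖ ^ 2 :=
    pow_le_pow_left₀ (norm_nonneg _) h2 2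
  -- The terminal energy is nonnegative and is dropped; what remains bounds the dissipation by the
  -- data.
  have h5 := sq_nonneg ‖S (trajectory a F U₀ U T)‖
  rw [h1] at h5
  set I := ∫ τ in Ioc 0 T, ‖(lapSymbol d).vop d₁ (U τ)‖ ^ 2
  have h6 : δ * I ≤ ‖U₀‖ ^ 2 + δ⁻¹ * Φ := by
    have : 2 * ((2 * δ)⁻¹ * Φ) = δ⁻¹ * Φ := by field_simp
    linarith
  calc I = δ⁻¹ * (δ * I) := by field_simp
    _ ≤ δ⁻¹ * (‖U₀‖ ^ 2 + δ⁻¹ * Φ) := by gcongr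
    _ = _ := by ring

theorem integral_norm_sq_le (hU : MemLp U 2 (volume.restrict (Ioc 0 T))) :
    ∫ τ in Ioc 0 T, ‖U τ‖ ^ 2 ≤ 2 * (∫ τ in Ioc 0 T, ‖(lapSymbol d).vop d₁ (U τ)‖ ^ 2) +
      2 * ∫ τ in Ioc 0 T, ‖(negBessel d (-2) (by norm_num)).vop d₁ (U τ)‖ ^ 2 := by
  have h1 := (integrable_norm_sq (hU.continuousLinearMap_comp ((lapSymbol d).vop d₁)))
  have h2 := (integrable_norm_sq
    (hU.continuousLinearMap_comp ((negBessel d (-2) (by norm_num)).vop d₁)))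
  rw [← integral_const_mul, ← integral_const_mul, ← integral_add (h1.const_mul _) (h2.const_mul _)]
  refine integral_mono (integrable_norm_sq hU) ((h1.const_mul _).add (h2.const_mul _)) fun τ ↦ ?_
  have h3 := norm_add_le ((lapSymbol d).vop d₁ (U τ)) ((negBessel d (-2) (by norm_num)).vop d₁ (U τ))
  rw [lap_add_negBessel_vop] at h3
  simp only
  nlinarith [norm_nonneg (U τ), sq_nonneg (‖(lapSymbol d).vop d₁ (U τ)‖ -
    ‖(negBessel d (-2) (by norm_num)).vop d₁ (U τ)‖)]

end

/-! ### Existence and uniqueness on the Fourier side -/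

section

variable {d d₁ : ℕ} {δ T : ℝ} {a : Coeff d d₁} {F : ℝ → VecL2 d d₁} {U₀ : VecL2 d d₁}
  {U : ℝ → VecL2 d d₁}

theorem cutoff_mul_self (n : ℕ) (ξ : Space d) : cutoff d n ξ * cutoff d n ξ = cutoff d n ξ := by
  by_cases hξ : ξ ∈ Metric.closedBall (0 : Space d) n <;> simp [cutoff, hξ]

theorem abs_cutoff_le_one (n : ℕ) (ξ : Space d) : |cutoff d n ξ| ≤ 1 := by
  by_cases hξ : ξ ∈ Metric.closedBall (0 : Space d) n <;> simp [cutoff, hξ]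

/-- The frequency-localised problem is an ordinary differential equation. -/
theorem Admissible.exists_cutoff_solution (ha : Admissible δ T a) (hT : 0 ≤ T)
    (hF : MemLp F 2 (volume.restrict (Ioc 0 T))) (U₀ : VecL2 d d₁) (n : ℕ) :
    ∃ U, IsMild T a (fun t ↦ (cutoff d n).vop d₁ (F t)) ((cutoff d n).vop d₁ U₀) U ∧
      ∀ᵐ t ∂(volume.restrict (Ioc 0 T)), (cutoff d n).vop d₁ (U t) = U t := by
  obtain ⟨C, hC0, hC⟩ := ha.exists_norm_coefOp_le
  set G := (besselCutoff d n).vop d₁ with hG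
  have hPF : MemLp (fun t ↦ (cutoff d n).vop d₁ (F t)) 2 (volume.restrict (Ioc 0 T)) :=
    hF.continuousLinearMap_comp _
  -- The unknown is `y = J U`. On frequencies of size at most `n`, `U` is recovered from it by the
  -- bounded operator `G`, so the equation for `y` has bounded coefficients.
  obtain ⟨y, hyc, hy⟩ := exists_linear_ode_solution hT (L := fun t ↦ (coefOp (a t)).comp G)
    (M := C * ‖G‖)
    ((ContinuousLinearMap.compL ℂ (VecL2 d d₁) (VecL2 d d₁) (VecL2 d d₁)).flip
      G |>.continuous.comp_aestronglyMeasurable ha.aestronglyMeasurable_coefOp)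
    (fun t ht ↦ (ContinuousLinearMap.opNorm_comp_le _ _).trans (by gcongr; exact hC t ht))
    (intervalIntegrable_of_memLp_two hT hPF)
    ((negBessel d (-1) (by norm_num)).vop d₁ ((cutoff d n).vop d₁ U₀))
  have hym : MemLp y 2 (volume.restrict (Ioc 0 T)) := by
    obtain ⟨D, hD⟩ := isCompact_Icc.exists_bound_of_continuousOn hyc
    refine MemLp.of_bound ((hyc.mono Ioc_subset_Icc_self).aestronglyMeasurable measurableSet_Ioc)
      D ?_
    filter_upwards [ae_restrict_mem measurableSet_Ioc] with t ht
    exact hD t (Ioc_subset_Icc_self ht)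
  have hU : MemLp (fun t ↦ G (y t)) 2 (volume.restrict (Ioc 0 T)) :=
    hym.continuousLinearMap_comp _
  have htraj : ∀ t ∈ Icc 0 T, y t = trajectory a (fun t ↦ (cutoff d n).vop d₁ (F t))
      ((cutoff d n).vop d₁ U₀) (fun t ↦ G (y t)) t := hy
  have hGP : ∀ x, (cutoff d n).vop d₁ (G x) = G x := BddSymbol.vop_vop fun ξ ↦ by
    by_cases hξ : ξ ∈ Metric.closedBall (0 : Space d) n <;> simp [cutoff, besselCutoff, hξ]
  have hPP : ∀ x, (cutoff d n).vop d₁ ((cutoff d n).vop d₁ x) = (cutoff d n).vop d₁ x :=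
    BddSymbol.vop_vop (cutoff_mul_self n)
  -- Localisation of `y` is needed because `J G` is the cutoff rather than the identity.
  have hyP : ∀ t ∈ Icc 0 T, (cutoff d n).vop d₁ (y t) = y t := by
    intro t ht
    have h1 := ha.map_trajectory (U₀ := (cutoff d n).vop d₁ U₀) hPF hU
      (((cutoff d n).vop d₁).restrictScalars ℝ) ht
    simp only [ContinuousLinearMap.coe_restrictScalars', map_add, ← coefOp_vop, hGP, hPP] at h1
    rw [BddSymbol.vop_vop_eq (m₁ := cutoff d n) (m₃ := negBessel d (-1) (by norm_num))
      (m₄ := cutoff d n) fun ξ ↦ mul_comm _ _, hPP] at h1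
    rw [htraj t ht]
    exact h1
  refine ⟨fun t ↦ G (y t), ⟨hU, ?_⟩, Eventually.of_forall fun t ↦ hGP _⟩
  filter_upwards [ae_restrict_mem measurableSet_Ioc] with t ht
  have ht' := Ioc_subset_Icc_self ht
  rw [← htraj t ht']
  refine Eq.trans ?_ (hyP t ht')
  refine BddSymbol.vop_vop (fun ξ ↦ ?_) _
  by_cases hξ : ξ ∈ Metric.closedBall (0 : Space d) n
  · simp only [cutoff, besselCutoff, negBessel, indicator_of_mem hξ, besselSymbol_mul]
    norm_num [besselSymbol_zero]
  · simp [cutoff, besselCutoff, hξ]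

theorem trajectory_sub (ha : Admissible δ T a) {F' U' : ℝ → VecL2 d d₁} {U₀' : VecL2 d d₁}
    (hF : MemLp F 2 (volume.restrict (Ioc 0 T))) (hF' : MemLp F' 2 (volume.restrict (Ioc 0 T)))
    (hU : MemLp U 2 (volume.restrict (Ioc 0 T))) (hU' : MemLp U' 2 (volume.restrict (Ioc 0 T)))
    {t : ℝ} (ht : t ∈ Icc 0 T) :
    trajectory a F U₀ U t - trajectory a F' U₀' U' t =
      trajectory a (fun t ↦ F t - F' t) (U₀ - U₀') (fun t ↦ U t - U' t) t := by
  have hT := ht.1.trans ht.2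
  rw [trajectory, trajectory, trajectory, map_sub, add_sub_add_comm,
    ← intervalIntegral.integral_sub
      ((ha.intervalIntegrable hT hF hU).mono_set (uIcc_subset_of_mem ht))
      ((ha.intervalIntegrable hT hF' hU').mono_set (uIcc_subset_of_mem ht))]
  congr 2
  funext τ
  rw [map_sub]
  abel

theorem IsMild.sub (ha : Admissible δ T a) {F' U' : ℝ → VecL2 d d₁} {U₀' : VecL2 d d₁}
    (hF : MemLp F 2 (volume.restrict (Ioc 0 T))) (hF' : MemLp F' 2 (volume.restrict (Ioc 0 T)))
    (h : IsMild T a F U₀ U) (h' : IsMild T a F' U₀' U') :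
    IsMild T a (fun t ↦ F t - F' t) (U₀ - U₀') (fun t ↦ U t - U' t) := by
  refine ⟨h.1.sub h'.1, ?_⟩
  filter_upwards [h.2, h'.2, ae_restrict_mem measurableSet_Ioc] with t h1 h2 ht
  rw [map_sub, h1, h2, trajectory_sub ha hF hF' h.1 h'.1 (Ioc_subset_Icc_self ht)]

/-- The difference solves the equation with zero data, and the trajectory estimate requires no
frequency localisation. Equality holds at every time, not just almost everywhere. -/
theorem IsMild.trajectory_unique (ha : Admissible δ T a) (hδ : 0 < δ) (hT : 0 < T)
    {U' : ℝ → VecL2 d d₁} (hF : MemLp F 2 (volume.restrict (Ioc 0 T)))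
    (h : IsMild T a F U₀ U) (h' : IsMild T a F U₀ U') {t : ℝ} (ht : t ∈ Icc 0 T) :
    trajectory a F U₀ U t = trajectory a F U₀ U' t := by
  have h1 := (h.sub ha hF hF h').norm_trajectory_sq_le (F := fun t ↦ F t - F t) ha hδ hT
    (hF.sub hF) ht
  rw [← trajectory_sub ha hF hF h.1 h'.1 ht] at h1
  simp only [sub_self, norm_zero] at h1
  rw [← sub_eq_zero, ← norm_eq_zero]
  have : ‖trajectory a F U₀ U t - trajectory a F U₀ U' t‖ ^ 2 ≤ 0 := by simpa using h1
  exact pow_eq_zero_iff two_ne_zero |>.1 (le_antisymm this (sq_nonneg _))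

/-- Cauchy–Schwarz, obtained from the nonnegativity of `∫ (‖g‖ - m/T)²` where `m / T` is the mean of
`‖g‖`. -/
theorem sq_integral_norm_le {X : Type*} [NormedAddCommGroup X] (hT : 0 < T) {g : ℝ → X}
    (hg : MemLp g 2 (volume.restrict (Ioc 0 T))) :
    (∫ τ in Ioc 0 T, ‖g τ‖) ^ 2 ≤ T * ∫ τ in Ioc 0 T, ‖g τ‖ ^ 2 := by
  set m := ∫ τ in Ioc 0 T, ‖g τ‖ with hm
  have h1 : Integrable (fun τ ↦ ‖g τ‖) (volume.restrict (Ioc 0 T)) :=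
    (hg.integrable (by norm_num)).norm
  have h2 := integrable_norm_sq hg
  have h3 : 0 ≤ ∫ τ in Ioc 0 T, (‖g τ‖ - m / T) ^ 2 := integral_nonneg fun τ ↦ sq_nonneg _
  have h4 : ∫ τ in Ioc 0 T, (‖g τ‖ - m / T) ^ 2 =
      (∫ τ in Ioc 0 T, ‖g τ‖ ^ 2) - 2 * (m / T) * m + T * (m / T) ^ 2 := by
    have h5 : ∀ τ, (‖g τ‖ - m / T) ^ 2 = ‖g τ‖ ^ 2 - 2 * (m / T) * ‖g τ‖ + (m / T) ^ 2 :=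
      fun τ ↦ by ring
    simp_rw [h5]
    rw [integral_add (f := fun τ ↦ ‖g τ‖ ^ 2 - 2 * (m / T) * ‖g τ‖) (h2.sub (h1.const_mul _))
      (integrable_const _), integral_sub h2 (h1.const_mul _),
      integral_const_mul, ← hm]
    simp [hT.le]
  rw [h4] at h3
  have h5 := mul_nonneg hT.le h3
  have h6 : T * ((∫ τ in Ioc 0 T, ‖g τ‖ ^ 2) - 2 * (m / T) * m + T * (m / T) ^ 2) =
      T * (∫ τ in Ioc 0 T, ‖g τ‖ ^ 2) - m ^ 2 := by
    field_simp
    ring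
  linarith

/-- A priori bound for frequency-localised solutions. -/
theorem IsMild.integral_norm_sq_le_of_cutoff (ha : Admissible δ T a) (hδ : 0 < δ) (hT : 0 < T)
    (hF : MemLp F 2 (volume.restrict (Ioc 0 T))) (h : IsMild T a F U₀ U) {n : ℕ}
    (hn : ∀ᵐ t ∂(volume.restrict (Ioc 0 T)), (cutoff d n).vop d₁ (U t) = U t) :
    ∫ τ in Ioc 0 T, ‖U τ‖ ^ 2 ≤ (2 * δ⁻¹ + 2 * δ⁻¹ ^ 2 + 4 * T + 8 * T ^ 2) *
      (‖U₀‖ ^ 2 + ∫ τ in Ioc 0 T, ‖F τ‖ ^ 2) := by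
  have h1 := integral_norm_sq_le h.1
  have h2 := h.integral_lap_sq_le ha hδ hT hF hn
  have h3 := h.integral_trajectory_sq_le ha hδ hT hF
  set Φ := ∫ τ in Ioc 0 T, ‖F τ‖ ^ 2
  have hΦ : 0 ≤ Φ := integral_nonneg fun τ ↦ sq_nonneg _
  have hδ' : 0 < δ⁻¹ := inv_pos.2 hδ
  have e1 : 0 ≤ δ⁻¹ * Φ := by positivity
  have e2 : 0 ≤ δ⁻¹ ^ 2 * ‖U₀‖ ^ 2 := by positivity
  have e3 : 0 ≤ T * Φ := by positivity
  have e4 : 0 ≤ T ^ 2 * ‖U₀‖ ^ 2 := by positivity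
  nlinarith

theorem norm_sq_toLp {X : Type*} [NormedAddCommGroup X] [InnerProductSpace ℂ X] {g : ℝ → X}
    (hg : MemLp g 2 (volume.restrict (Ioc 0 T))) :
    ‖hg.toLp g‖ ^ 2 = ∫ τ in Ioc 0 T, ‖g τ‖ ^ 2 := by
  rw [norm_sq_lp_two]
  refine integral_congr_ae ?_
  filter_upwards [hg.coeFn_toLp] with t ht
  rw [ht]

/-- Both cutoffs equal `1` on the ball of radius `N`, and their symbols differ by at most `1`
outside it, so the tail beyond `N` bounds the difference. -/
theorem norm_cutoff_sub_cutoff_le {N n m : ℕ} (hn : N ≤ n) (hm : N ≤ m) (x : VecL2 d d₁) :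
    ‖(cutoff d n).vop d₁ x - (cutoff d m).vop d₁ x‖ ≤ ‖(cutoff d N).vop d₁ x - x‖ := by
  refine norm_le_of_components fun k ↦ ?_
  change ‖(cutoff d n).op (x k) - (cutoff d m).op (x k)‖ ≤ ‖(cutoff d N).op (x k) - x k‖
  refine Lp.norm_le_norm_of_ae_le ?_
  filter_upwards [(cutoff d n).coeFn_op (x k), (cutoff d m).coeFn_op (x k),
    (cutoff d N).coeFn_op (x k), Lp.coeFn_sub ((cutoff d n).op (x k)) ((cutoff d m).op (x k)),
    Lp.coeFn_sub ((cutoff d N).op (x k)) (x k)] with ξ h1 h2 h3 h4 h5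
  rw [h4, h5, Pi.sub_apply, Pi.sub_apply, h1, h2, h3]
  by_cases hξ : ξ ∈ Metric.closedBall (0 : Space d) N
  · have h6 : ξ ∈ Metric.closedBall (0 : Space d) n :=
      Metric.closedBall_subset_closedBall (by exact_mod_cast hn) hξ
    have h7 : ξ ∈ Metric.closedBall (0 : Space d) m :=
      Metric.closedBall_subset_closedBall (by exact_mod_cast hm) hξ
    simp only [cutoff, indicator_of_mem h6, indicator_of_mem h7, sub_self, norm_zero]
    positivity
  · have h6 : ‖(cutoff d N ξ : ℂ) * (x k) ξ - (x k) ξ‖ = ‖(x k) ξ‖ := by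
      simp [cutoff, indicator_of_notMem hξ]
    rw [h6]
    by_cases h7 : ξ ∈ Metric.closedBall (0 : Space d) n <;>
    by_cases h8 : ξ ∈ Metric.closedBall (0 : Space d) m <;>
    simp [cutoff, h7, h8]

theorem norm_cutoff_sub_self_le (N : ℕ) (x : VecL2 d d₁) :
    ‖(cutoff d N).vop d₁ x - x‖ ≤ ‖x‖ := by
  refine norm_le_of_components fun k ↦ ?_
  change ‖(cutoff d N).op (x k) - x k‖ ≤ ‖x k‖
  refine Lp.norm_le_norm_of_ae_le ?_
  filter_upwards [(cutoff d N).coeFn_op (x k), Lp.coeFn_sub ((cutoff d N).op (x k)) (x k)]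
    with ξ h1 h2
  rw [h2, Pi.sub_apply, h1]
  by_cases h7 : ξ ∈ Metric.closedBall (0 : Space d) N <;> simp [cutoff, h7]

/-- Continuity of the trajectory in all its data, with `C` chosen before them; applied to
differences, it allows passage to the limit at each fixed time. -/
theorem Admissible.exists_norm_trajectory_le (ha : Admissible δ T a) (hT : 0 < T) :
    ∃ C, ∀ (F U : ℝ → VecL2 d d₁) (U₀ : VecL2 d d₁), MemLp F 2 (volume.restrict (Ioc 0 T)) →
      MemLp U 2 (volume.restrict (Ioc 0 T)) → ∀ t ∈ Icc 0 T, ‖trajectory a F U₀ U t‖ ≤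
        ‖U₀‖ + (C * √(T * ∫ τ in Ioc 0 T, ‖U τ‖ ^ 2) + √(T * ∫ τ in Ioc 0 T, ‖F τ‖ ^ 2)) := by
  obtain ⟨C, hC0, hC⟩ := ha.exists_norm_coefOp_le
  refine ⟨C, fun F U U₀ hF hU t ht ↦ (norm_add_le _ _).trans
    (add_le_add (negBessel_norm_vop_le _ _) ?_)⟩
  have iU : Integrable (fun τ ↦ ‖U τ‖) (volume.restrict (Ioc 0 T)) :=
    (hU.integrable (by norm_num)).norm
  have iF : Integrable (fun τ ↦ ‖F τ‖) (volume.restrict (Ioc 0 T)) :=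
    (hF.integrable (by norm_num)).norm
  have hb : Integrable (fun τ ↦ C * ‖U τ‖ + ‖F τ‖) (volume.restrict (Ioc 0 T)) :=
    (iU.const_mul C).add iF
  calc _ ≤ ∫ τ in (0 : ℝ)..t, (C * ‖U τ‖ + ‖F τ‖) := by
        refine intervalIntegral.norm_integral_le_of_norm_le ht.1
          (Eventually.of_forall fun τ hτ ↦ ?_) ?_
        · refine (norm_add_le _ _).trans (add_le_add ?_ le_rfl)
          refine ((coefOp (a τ)).le_opNorm _).trans ?_
          gcongr
          exact hC τ ⟨hτ.1, hτ.2.trans ht.2⟩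
        · exact ((intervalIntegrable_iff_integrableOn_Ioc_of_le hT.le).2 hb).mono_set
            (uIcc_subset_of_mem ht)
    _ ≤ ∫ τ in Ioc 0 T, (C * ‖U τ‖ + ‖F τ‖) := by
        rw [intervalIntegral.integral_of_le ht.1]
        exact setIntegral_mono_set hb (Eventually.of_forall fun τ ↦ by positivity)
          (Ioc_subset_Ioc_right ht.2).eventuallyLE
    _ = C * (∫ τ in Ioc 0 T, ‖U τ‖) + ∫ τ in Ioc 0 T, ‖F τ‖ := by
        rw [integral_add (iU.const_mul C) iF, integral_const_mul]
    _ ≤ _ := by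
        gcongr
        · exact Real.le_sqrt_of_sq_le (sq_integral_norm_le hT hU)
        · exact Real.le_sqrt_of_sq_le (sq_integral_norm_le hT hF)

/-- Existence for the system on the Fourier side, with the estimate of second derivatives. -/
theorem Admissible.exists_isMild (ha : Admissible δ T a) (hδ : 0 < δ) (hT : 0 < T)
    (hF : MemLp F 2 (volume.restrict (Ioc 0 T))) (U₀ : VecL2 d d₁) :
    ∃ U, IsMild T a F U₀ U ∧ ∫ τ in Ioc 0 T, ‖(lapSymbol d).vop d₁ (U τ)‖ ^ 2 ≤
      δ⁻¹ * ‖U₀‖ ^ 2 + δ⁻¹ ^ 2 * ∫ τ in Ioc 0 T, ‖F τ‖ ^ 2 := by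
  choose U hU hcut using fun n ↦ ha.exists_cutoff_solution hT.le hF U₀ n
  have hPF : ∀ n, MemLp (fun t ↦ (cutoff d n).vop d₁ (F t)) 2 (volume.restrict (Ioc 0 T)) :=
    fun n ↦ hF.continuousLinearMap_comp _
  have hFs := integrable_norm_sq hF
  let V : ℕ → Lp (VecL2 d d₁) 2 (volume.restrict (Ioc 0 T)) := fun n ↦ (hU n).1.toLp (U n)
  set K := 2 * δ⁻¹ + 2 * δ⁻¹ ^ 2 + 4 * T + 8 * T ^ 2
  have hK : 0 ≤ K := by positivity
  let e : ℕ → ℝ := fun N ↦ ∫ τ in Ioc 0 T, ‖(cutoff d N).vop d₁ (F τ) - F τ‖ ^ 2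
  have hU₀lim : Tendsto (fun N ↦ ‖(cutoff d N).vop d₁ U₀ - U₀‖) atTop (𝓝 0) :=
    tendsto_iff_norm_sub_tendsto_zero.1 (tendsto_cutoff_vop U₀)
  have he : Tendsto e atTop (𝓝 0) := by
    have h1 : Tendsto e atTop (𝓝 (∫ τ in Ioc 0 T, (0 : ℝ))) := by
      refine tendsto_integral_of_dominated_convergence (fun τ ↦ ‖F τ‖ ^ 2)
        (fun n ↦ (((hPF n).sub hF).1.norm.pow 2)) hFs
        (fun n ↦ Eventually.of_forall fun τ ↦ ?_) (Eventually.of_forall fun τ ↦ ?_)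
      · rw [Real.norm_eq_abs, abs_of_nonneg (sq_nonneg _)]
        exact pow_le_pow_left₀ (norm_nonneg _) (norm_cutoff_sub_self_le n _) 2
      · simpa using (tendsto_iff_norm_sub_tendsto_zero.1 (tendsto_cutoff_vop (F τ))).pow 2
    simpa using h1
  let b : ℕ → ℝ := fun N ↦ √(K * (‖(cutoff d N).vop d₁ U₀ - U₀‖ ^ 2 + e N))
  have hb : Tendsto b atTop (𝓝 0) := by
    have := (((hU₀lim.pow 2).add he).const_mul K).sqrt
    simpa using this
  -- The difference of two localised solutions is again localised, at `max n m`, and solves the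
  -- equation with the differences of the cut-off data. Since `K` does not depend on the cutoff, the
  -- a priori bound gives the Cauchy property.
  have hdist : ∀ n m N, N ≤ n → N ≤ m → dist (V n) (V m) ≤ b N := by
    intro n m N hn hm
    have h1 : dist (V n) (V m) ^ 2 = ∫ τ in Ioc 0 T, ‖U n τ - U m τ‖ ^ 2 := by
      rw [dist_eq_norm, ← MemLp.toLp_sub, norm_sq_toLp]
      rfl
    have h2 := (hU n).sub ha (hPF n) (hPF m) (hU m)
    have h3 : ∀ᵐ t ∂(volume.restrict (Ioc 0 T)),
        (cutoff d (max n m)).vop d₁ (U n t - U m t) = U n t - U m t := by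
      filter_upwards [hcut n, hcut m] with t h4 h5
      have h6 : ∀ p ≤ max n m, ∀ x : VecL2 d d₁,
          (cutoff d (max n m)).vop d₁ ((cutoff d p).vop d₁ x) = (cutoff d p).vop d₁ x := by
        intro p hp x
        refine BddSymbol.vop_vop (fun ξ ↦ ?_) x
        by_cases h7 : ξ ∈ Metric.closedBall (0 : Space d) p
        · have h8 : ξ ∈ Metric.closedBall (0 : Space d) (max n m : ℕ) :=
            Metric.closedBall_subset_closedBall (by exact_mod_cast hp) h7
          simp only [cutoff, indicator_of_mem h8, Pi.one_apply, one_mul]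
        · simp [cutoff, indicator_of_notMem h7]
      rw [map_sub]
      congr 1
      · rw [← h4, h6 n (le_max_left _ _)]
      · rw [← h5, h6 m (le_max_right _ _)]
    have h4 := h2.integral_norm_sq_le_of_cutoff ha hδ hT ((hPF n).sub (hPF m)) h3
    refine Real.le_sqrt_of_sq_le ?_
    rw [h1]
    refine h4.trans (mul_le_mul_of_nonneg_left (add_le_add ?_ ?_) hK)
    · exact pow_le_pow_left₀ (norm_nonneg _) (norm_cutoff_sub_cutoff_le hn hm _) 2
    · refine integral_mono (integrable_norm_sq ((hPF n).sub (hPF m)))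
        (integrable_norm_sq ((hPF N).sub hF)) fun τ ↦ ?_
      exact pow_le_pow_left₀ (norm_nonneg _) (norm_cutoff_sub_cutoff_le hn hm _) 2
  obtain ⟨W, hW⟩ := cauchySeq_tendsto_of_complete (cauchySeq_of_le_tendsto_0 b hdist hb)
  have hWm : MemLp W 2 (volume.restrict (Ioc 0 T)) := Lp.memLp W
  have hUW : Tendsto (fun n ↦ ∫ τ in Ioc 0 T, ‖U n τ - W τ‖ ^ 2) atTop (𝓝 0) := by
    have h1 := (tendsto_iff_norm_sub_tendsto_zero.1 hW).pow 2
    rw [zero_pow two_ne_zero] at h1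
    refine h1.congr fun n ↦ ?_
    have h2 : V n - W = ((hU n).1.sub hWm).toLp (U n - ⇑W) := by
      rw [MemLp.toLp_sub (hU n).1 hWm, Lp.toLp_coeFn]
    rw [h2, norm_sq_toLp]
    rfl
  obtain ⟨C, hC⟩ := ha.exists_norm_trajectory_le hT
  have htraj : ∀ t ∈ Icc 0 T, Tendsto (fun n ↦ trajectory a (fun t ↦ (cutoff d n).vop d₁ (F t))
      ((cutoff d n).vop d₁ U₀) (U n) t) atTop (𝓝 (trajectory a F U₀ W t)) := by
    intro t ht
    rw [tendsto_iff_norm_sub_tendsto_zero]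
    have h1 : Tendsto (fun n ↦ ‖(cutoff d n).vop d₁ U₀ - U₀‖ +
        (C * √(T * ∫ τ in Ioc 0 T, ‖U n τ - W τ‖ ^ 2) + √(T * e n))) atTop (𝓝 0) := by
      have := hU₀lim.add ((((hUW.const_mul T).sqrt).const_mul C).add (he.const_mul T).sqrt)
      simpa using this
    refine squeeze_zero (fun n ↦ norm_nonneg _) (fun n ↦ ?_) h1
    rw [trajectory_sub ha (hPF n) hF (hU n).1 hWm ht]
    exact hC _ _ _ ((hPF n).sub hF) ((hU n).1.sub hWm) t ht
  refine ⟨W, ⟨hWm, ?_⟩, ?_⟩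
  -- Convergence in `L²` in time gives pointwise convergence a.e. along a subsequence, while the
  -- trajectories converge at every time; the two limits must agree.
  · obtain ⟨ns, hns, hlim⟩ := (tendstoInMeasure_of_tendsto_Lp hW).exists_seq_tendsto_ae
    have hV : ∀ᵐ t ∂(volume.restrict (Ioc 0 T)), ∀ n, V n t = U n t :=
      ae_all_iff.2 fun n ↦ (hU n).1.coeFn_toLp
    filter_upwards [hlim, hV, ae_all_iff.2 fun n ↦ (hU n).2, ae_restrict_mem measurableSet_Ioc]
      with t h1 h2 h3 ht
    have h4 := (((negBessel d (-2) (by norm_num)).vop d₁).continuous.tendsto _).comp h1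
    have h5 := (htraj t (Ioc_subset_Icc_self ht)).comp hns.tendsto_atTop
    refine tendsto_nhds_unique h4 (h5.congr fun n ↦ ?_)
    simp only [Function.comp]
    rw [h2, h3]
  · have h1 := (((lapSymbol d).vop d₁).compLpL 2 (volume.restrict (Ioc 0 T))).continuous.tendsto W
      |>.comp hW |>.norm.pow 2
    have h2 : ‖((lapSymbol d).vop d₁).compLpL 2 (volume.restrict (Ioc 0 T)) W‖ ^ 2 =
        ∫ τ in Ioc 0 T, ‖(lapSymbol d).vop d₁ (W τ)‖ ^ 2 := by
      rw [norm_sq_lp_two]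
      refine integral_congr_ae ?_
      filter_upwards [((lapSymbol d).vop d₁).coeFn_compLpL W] with t ht
      rw [ht]
    rw [← h2]
    refine le_of_tendsto' h1 fun n ↦ ?_
    have h3 : ‖((lapSymbol d).vop d₁).compLpL 2 (volume.restrict (Ioc 0 T)) (V n)‖ ^ 2 =
        ∫ τ in Ioc 0 T, ‖(lapSymbol d).vop d₁ (U n τ)‖ ^ 2 := by
      rw [norm_sq_lp_two]
      refine integral_congr_ae ?_
      filter_upwards [((lapSymbol d).vop d₁).coeFn_compLpL (V n), (hU n).1.coeFn_toLp] with t ht h4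
      rw [ht, h4]
    simp only [Function.comp]
    rw [h3]
    refine ((hU n).integral_lap_sq_le ha hδ hT (hPF n) (hcut n)).trans ?_
    have hδ' : 0 < δ⁻¹ := inv_pos.2 hδ
    gcongr ?_ + ?_
    · gcongr
      exact BddSymbol.norm_vop_le_self (abs_cutoff_le_one n) U₀
    · gcongr ?_ * ?_
      refine integral_mono (integrable_norm_sq (hPF n)) hFs fun τ ↦ ?_
      exact pow_le_pow_left₀ (norm_nonneg _)
        (BddSymbol.norm_vop_le_self (abs_cutoff_le_one n) _) 2

end

/-! ### Translation between distributions and frequency representatives -/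

section

variable {d d₁ : ℕ}

/-- The tuple of distributions with frequency representation `x` in `H^s_2`. -/
def vecDist (s : ℝ) (x : VecL2 d d₁) : VecDistribution d d₁ := fun k ↦ freqDist s (x k)

/-- The frequency representation of a tuple of distributions in `H^s_2`. -/
def freqRep (s : ℝ) (v : VecDistribution d d₁) : VecL2 d d₁ :=
  WithLp.toLp 2 fun k ↦ (𝓕 (besselRep s (v k)) : L2 d)

theorem freqRep_apply (s : ℝ) (v : VecDistribution d d₁) (k : Fin d₁) :
    freqRep s v k = (𝓕 (besselRep s (v k)) : L2 d) := rfl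

theorem vecDist_injective (s : ℝ) :
    Function.Injective (vecDist s : VecL2 d d₁ → VecDistribution d d₁) := by
  intro x y h
  ext k : 1
  exact freqDist_injective s (congrFun h k)

theorem freqRep_vecDist (s : ℝ) (x : VecL2 d d₁) : freqRep s (vecDist s x) = x := by
  ext k : 1
  rw [freqRep_apply, vecDist, besselRep_freqDist, FourierTransform.fourier_fourierInv_eq]

theorem vecDist_freqRep {s : ℝ} {v : VecDistribution d d₁} (hv : MemH s v) :
    vecDist s (freqRep s v) = v :=
  funext fun k ↦ freqDist_fourier_besselRep (hv k).2

theorem hNorm_eq (s : ℝ) (v : VecDistribution d d₁) : hNorm s v = ‖freqRep s v‖ := by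
  rw [hNorm, ← Real.sqrt_sq (norm_nonneg (freqRep s v)), norm_sq_vec]
  simp [freqRep_apply]

theorem bhNorm_eq (s T : ℝ) (u : ℝ → VecDistribution d d₁) :
    bhNorm s T u = √(∫ t in Ioc 0 T, ‖freqRep s (u t)‖ ^ 2) := by
  simp_rw [bhNorm, hNorm_eq]

/-- The componentwise conjugate reflection. -/
def vecConj (d d₁ : ℕ) : VecL2 d d₁ →L[ℝ] VecL2 d d₁ :=
  (PiLp.continuousLinearEquiv 2 ℝ (fun _ : Fin d₁ ↦ L2 d)).symm.toContinuousLinearMap ∘L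
    ContinuousLinearMap.pi fun k ↦ conjRefl d ∘L PiLp.proj 2 (fun _ : Fin d₁ ↦ L2 d) k

theorem vecConj_apply (x : VecL2 d d₁) (k : Fin d₁) : vecConj d d₁ x k = conjRefl d (x k) := rfl

theorem vecConj_vop (m : BddSymbol d) (x : VecL2 d d₁) :
    vecConj d d₁ (m.vop d₁ x) = m.vop d₁ (vecConj d d₁ x) := by
  ext k : 1
  exact conjRefl_op m (x k)

theorem vecConj_coefOp (A : Fin d → Fin d → Matrix (Fin d₁) (Fin d₁) ℝ) (x : VecL2 d d₁) :
    vecConj d d₁ (coefOp A x) = coefOp A (vecConj d d₁ x) := by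
  ext k : 1
  rw [vecConj_apply, coefOp_apply, coefOp_apply]
  simp only [map_sum, conjRefl_conj_smul, Complex.conj_ofReal, conjRefl_op, vecConj_apply]

theorem vecConj_eq_iff (s : ℝ) (x : VecL2 d d₁) :
    vecConj d d₁ x = x ↔ ∀ k, IsRealDistribution (vecDist s x k) := by
  constructor
  · intro h k
    rw [vecDist, isRealDistribution_freqDist_iff, ← vecConj_apply, h]
  · intro h
    ext k : 1
    exact (isRealDistribution_freqDist_iff s (x k)).1 (h k)

theorem memH_vecDist {s : ℝ} {x : VecL2 d d₁} (h : vecConj d d₁ x = x) : MemH s (vecDist s x) :=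
  fun k ↦ ⟨(vecConj_eq_iff s x).1 h k, memScalarH_freqDist s _⟩

theorem MemH.vecConj_freqRep {s : ℝ} {v : VecDistribution d d₁} (hv : MemH s v) :
    vecConj d d₁ (freqRep s v) = freqRep s v := by
  rw [vecConj_eq_iff s, vecDist_freqRep hv]
  exact fun k ↦ (hv k).1

theorem memLp_of_components {α : Type*} [MeasurableSpace α] {μ : Measure α} {G : α → VecL2 d d₁}
    (h : ∀ k, MemLp (fun t ↦ G t k) 2 μ) : MemLp G 2 μ := by
  have h1 : MemLp (fun t k ↦ G t k) 2 μ := MemLp.of_eval h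
  exact h1.continuousLinearMap_comp
    (PiLp.continuousLinearEquiv 2 ℂ (fun _ : Fin d₁ ↦ L2 d)).symm.toContinuousLinearMap

theorem MemBH.memLp_freqRep {s T : ℝ} {u : ℝ → VecDistribution d d₁} (hu : MemBH s T u) :
    MemLp (fun t ↦ freqRep s (u t)) 2 (volume.restrict (Ioc 0 T)) :=
  memLp_of_components fun k ↦ (hu.2 k).continuousLinearMap_comp
    (Lp.fourierTransformₗᵢ (Space d) ℂ).toContinuousLinearEquiv.toContinuousLinearMap

theorem memBH_of_freq {s T : ℝ} {u : ℝ → VecDistribution d d₁} {G : ℝ → VecL2 d d₁}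
    (hG : MemLp G 2 (volume.restrict (Ioc 0 T)))
    (hc : ∀ᵐ t ∂(volume.restrict (Ioc 0 T)), vecConj d d₁ (G t) = G t)
    (hu : ∀ᵐ t ∂(volume.restrict (Ioc 0 T)), u t = vecDist s (G t)) : MemBH s T u := by
  refine ⟨?_, fun k ↦ ?_⟩
  · filter_upwards [hc, hu] with t h1 h2
    rw [h2]
    exact memH_vecDist h1
  · refine (hG.continuousLinearMap_comp
      ((Lp.fourierTransformₗᵢ (Space d) ℂ).symm.toContinuousLinearEquiv.toContinuousLinearMap ∘L
        PiLp.proj 2 (fun _ : Fin d₁ ↦ L2 d) k)).ae_eq ?_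
    filter_upwards [hu] with t h
    rw [h, vecDist, besselRep_freqDist]
    rfl

theorem bhNorm_eq_of_freq {s T : ℝ} {u : ℝ → VecDistribution d d₁} {G : ℝ → VecL2 d d₁}
    (hu : ∀ᵐ t ∂(volume.restrict (Ioc 0 T)), u t = vecDist s (G t)) :
    bhNorm s T u = √(∫ t in Ioc 0 T, ‖G t‖ ^ 2) := by
  rw [bhNorm_eq]
  congr 1
  refine integral_congr_ae ?_
  filter_upwards [hu] with t h
  rw [h, freqRep_vecDist]

theorem vecDist_negBessel_two (γ : ℝ) (x : VecL2 d d₁) :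
    vecDist γ ((negBessel d (-2) (by norm_num)).vop d₁ x) = vecDist (γ + 2) x := by
  funext k
  rw [vecDist, vecDist, BddSymbol.vop_apply, freqDist_negBessel, sub_neg_eq_add]

theorem vecDist_negBessel_one (γ : ℝ) (x : VecL2 d d₁) :
    vecDist γ ((negBessel d (-1) (by norm_num)).vop d₁ x) = vecDist (γ + 1) x := by
  funext k
  rw [vecDist, vecDist, BddSymbol.vop_apply, freqDist_negBessel, sub_neg_eq_add]

theorem secondDeriv_vecDist (γ : ℝ) (i j : Fin d) (x : VecL2 d d₁) :
    secondDeriv i j (vecDist (γ + 2) x) = vecDist γ ((hessSymbol i j).vop d₁ x) :=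
  funext fun k ↦ hessian_freqDist γ i j (x k)

theorem systemRHS_eq {γ : ℝ} {a : Coeff d d₁} {f u : ℝ → VecDistribution d d₁} {t : ℝ}
    {x y : VecL2 d d₁} (hu : u t = vecDist (γ + 2) x) (hf : f t = vecDist γ y) :
    systemRHS a f u t = vecDist γ (coefOp (a t) x + y) := by
  funext k
  simp only [systemRHS, hu, hf, secondDeriv_vecDist, vecDist, PiLp.add_apply, coefOp_apply,
    map_add, map_sum, map_smul, BddSymbol.vop_apply]

/-- The pairing of the `k`-th component with a test function, as a functional on the Fourier
side. -/
def testFunctional (γ : ℝ) (k : Fin d₁) (φ : 𝓢(Space d, ℂ)) : VecL2 d d₁ →L[ℂ] ℂ :=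
  PointwiseConvergenceCLM.evalCLM (RingHom.id ℂ) ℂ φ ∘L freqDist γ ∘L
    PiLp.proj 2 (fun _ : Fin d₁ ↦ L2 d) k

theorem testFunctional_apply (γ : ℝ) (k : Fin d₁) (φ : 𝓢(Space d, ℂ)) (x : VecL2 d d₁) :
    testFunctional γ k φ x = vecDist γ x k φ := rfl

section Solution

variable {γ δ T : ℝ} {a : Coeff d d₁} {F : ℝ → VecL2 d d₁} {U₀ : VecL2 d d₁} {U : ℝ → VecL2 d d₁}

/-- Pairing with a test function is a bounded functional on `L²`, so it passes through the Bochner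
integral and gives the tested form of the equation. -/
theorem Admissible.vecDist_trajectory (ha : Admissible δ T a)
    (hF : MemLp F 2 (volume.restrict (Ioc 0 T))) (hU : MemLp U 2 (volume.restrict (Ioc 0 T)))
    (k : Fin d₁) (φ : 𝓢(Space d, ℂ)) {t : ℝ} (ht : t ∈ Icc 0 T) :
    vecDist γ (trajectory a F U₀ U t) k φ = vecDist (γ + 1) U₀ k φ +
      ∫ τ in (0 : ℝ)..t, vecDist γ (coefOp (a τ) (U τ) + F τ) k φ := by
  have h := (testFunctional γ k φ).intervalIntegral_comp_comm
    ((ha.intervalIntegrable (ht.1.trans ht.2) hF hU).mono_set (uIcc_subset_of_mem ht))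
  simp_rw [testFunctional_apply] at h
  rw [h, ← testFunctional_apply, trajectory, map_add, testFunctional_apply, vecDist_negBessel_one,
    testFunctional_apply]

/-- The conjugate reflection of `U` solves the same problem, since the data are symmetric and the
coefficients real; uniqueness identifies the trajectories. -/
theorem IsMild.vecConj_trajectory (ha : Admissible δ T a) (hδ : 0 < δ) (hT : 0 < T)
    (hF : MemLp F 2 (volume.restrict (Ioc 0 T)))
    (hFc : ∀ᵐ t ∂(volume.restrict (Ioc 0 T)), vecConj d d₁ (F t) = F t)
    (hU₀c : vecConj d d₁ U₀ = U₀) (h : IsMild T a F U₀ U) {t : ℝ} (ht : t ∈ Icc 0 T) :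
    vecConj d d₁ (trajectory a F U₀ U t) = trajectory a F U₀ U t := by
  have h1 : ∀ t ∈ Icc 0 T, vecConj d d₁ (trajectory a F U₀ U t) =
      trajectory a F U₀ (fun t ↦ vecConj d d₁ (U t)) t := by
    intro t ht
    rw [ha.map_trajectory hF h.1 (vecConj d d₁) ht, vecConj_vop, hU₀c, trajectory,
      intervalIntegral.integral_of_le ht.1, intervalIntegral.integral_of_le ht.1]
    congr 1
    refine integral_congr_ae ?_
    filter_upwards [ae_uIoc_of_ae_restrict hFc ht] with τ hτ
    rw [map_add, vecConj_coefOp, hτ]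
  have h2 : IsMild T a F U₀ (fun t ↦ vecConj d d₁ (U t)) := by
    refine ⟨h.1.continuousLinearMap_comp _, ?_⟩
    filter_upwards [h.2, ae_restrict_mem measurableSet_Ioc] with t h3 h4
    rw [← vecConj_vop, h3, h1 t (Ioc_subset_Icc_self h4)]
  rw [h1 t ht]
  exact h2.trajectory_unique ha hδ hT hF h ht

theorem IsMild.vecDist_eq (h : IsMild T a F U₀ U) :
    ∀ᵐ t ∂(volume.restrict (Ioc 0 T)),
      vecDist γ (trajectory a F U₀ U t) = vecDist (γ + 2) (U t) := by
  filter_upwards [h.2] with t h1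
  rw [← h1, vecDist_negBessel_two]

theorem IsMild.vecConj_ae (ha : Admissible δ T a) (hδ : 0 < δ) (hT : 0 < T)
    (hF : MemLp F 2 (volume.restrict (Ioc 0 T)))
    (hFc : ∀ᵐ t ∂(volume.restrict (Ioc 0 T)), vecConj d d₁ (F t) = F t)
    (hU₀c : vecConj d d₁ U₀ = U₀) (h : IsMild T a F U₀ U) :
    ∀ᵐ t ∂(volume.restrict (Ioc 0 T)), vecConj d d₁ (U t) = U t := by
  -- Reality of the distribution can be read off at any Sobolev index, so `0` is an arbitrary
  -- choice; it transfers symmetry from the trajectory to `U`.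
  filter_upwards [h.vecDist_eq (γ := 0), ae_restrict_mem measurableSet_Ioc] with t h1 ht
  rw [vecConj_eq_iff (0 + 2), ← h1, ← vecConj_eq_iff]
  exact h.vecConj_trajectory ha hδ hT hF hFc hU₀c (Ioc_subset_Icc_self ht)

/-- Solutions of the Fourier side system give solutions of the original one. -/
theorem IsMild.isSolution (ha : Admissible δ T a) (hδ : 0 < δ) (hT : 0 < T)
    {f : ℝ → VecDistribution d d₁} {u₀ : VecDistribution d d₁} (hu₀ : MemH (γ + 1) u₀)
    (hf : MemBH γ T f)
    (h : IsMild T a (fun t ↦ freqRep γ (f t)) (freqRep (γ + 1) u₀) U) :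
    IsSolution γ T a f u₀ fun t ↦
      vecDist γ (trajectory a (fun t ↦ freqRep γ (f t)) (freqRep (γ + 1) u₀) U t) := by
  have hF := hf.memLp_freqRep
  have hFc : ∀ᵐ t ∂(volume.restrict (Ioc 0 T)),
      vecConj d d₁ (freqRep γ (f t)) = freqRep γ (f t) := hf.1.mono fun t h ↦ h.vecConj_freqRep
  have hUc := h.vecConj_ae ha hδ hT hF hFc hu₀.vecConj_freqRep
  have h0 : vecDist γ (trajectory a (fun t ↦ freqRep γ (f t)) (freqRep (γ + 1) u₀) U 0) = u₀ := by
    rw [trajectory, intervalIntegral.integral_same, add_zero, vecDist_negBessel_one,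
      vecDist_freqRep hu₀]
  have hrhs : ∀ᵐ t ∂(volume.restrict (Ioc 0 T)), systemRHS a f (fun t ↦
      vecDist γ (trajectory a (fun t ↦ freqRep γ (f t)) (freqRep (γ + 1) u₀) U t)) t =
      vecDist γ (coefOp (a t) (U t) + freqRep γ (f t)) := by
    filter_upwards [h.vecDist_eq (γ := γ), hf.1] with t h1 h2
    exact systemRHS_eq h1 (vecDist_freqRep h2).symm
  have hderiv : HasTimeDeriv γ T (fun t ↦
      vecDist γ (trajectory a (fun t ↦ freqRep γ (f t)) (freqRep (γ + 1) u₀) U t))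
      (systemRHS a f fun t ↦
        vecDist γ (trajectory a (fun t ↦ freqRep γ (f t)) (freqRep (γ + 1) u₀) U t)) := by
    refine ⟨memBH_of_freq ((ha.memLp_coefOp h.1).add hF) ?_ hrhs, fun φ _ k t ht ↦ ?_⟩
    · filter_upwards [hUc, hFc] with t h1 h2
      simp only [Pi.add_apply, map_add]
      rw [vecConj_coefOp, h1, h2]
    · simp only [h0]
      rw [ha.vecDist_trajectory hF h.1 k φ ht, vecDist_freqRep hu₀,
        intervalIntegral.integral_of_le ht.1, intervalIntegral.integral_of_le ht.1]
      congr 1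
      refine integral_congr_ae ?_
      filter_upwards [ae_uIoc_of_ae_restrict hrhs ht] with τ hτ
      rw [hτ]
  refine ⟨⟨memBH_of_freq h.1 hUc h.vecDist_eq, ?_, _, hderiv⟩, h0, hderiv⟩
  simp only [h0]
  exact hu₀

/-- Solutions of the original system give solutions of the Fourier side one. -/
theorem IsSolution.isMild (ha : Admissible δ T a) {f : ℝ → VecDistribution d d₁}
    {u₀ : VecDistribution d d₁} (hu₀ : MemH (γ + 1) u₀) (hf : MemBH γ T f)
    {v : ℝ → VecDistribution d d₁} (hv : IsSolution γ T a f u₀ v) :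
    IsMild T a (fun t ↦ freqRep γ (f t)) (freqRep (γ + 1) u₀) (fun t ↦ freqRep (γ + 2) (v t)) ∧
      ∀ t ∈ Icc 0 T, v t = vecDist γ (trajectory a (fun t ↦ freqRep γ (f t))
        (freqRep (γ + 1) u₀) (fun t ↦ freqRep (γ + 2) (v t)) t) := by
  obtain ⟨⟨hvB, -, -⟩, hv0, hvd⟩ := hv
  have hF := hf.memLp_freqRep
  have hV := hvB.memLp_freqRep
  have hrhs : ∀ᵐ t ∂(volume.restrict (Ioc 0 T)), systemRHS a f v t =
      vecDist γ (coefOp (a t) (freqRep (γ + 2) (v t)) + freqRep γ (f t)) := by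
    filter_upwards [hvB.1, hf.1] with t h1 h2
    exact systemRHS_eq (vecDist_freqRep h1).symm (vecDist_freqRep h2).symm
  have key : ∀ t ∈ Icc 0 T, v t = vecDist γ (trajectory a (fun t ↦ freqRep γ (f t))
      (freqRep (γ + 1) u₀) (fun t ↦ freqRep (γ + 2) (v t)) t) := by
    intro t ht
    funext k
    refine temperedDistribution_ext_of_hasCompactSupport fun φ hφ ↦ ?_
    rw [hvd.2 φ hφ k t ht, ha.vecDist_trajectory hF hV k φ ht, hv0, vecDist_freqRep hu₀,
      intervalIntegral.integral_of_le ht.1, intervalIntegral.integral_of_le ht.1]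
    congr 1
    refine integral_congr_ae ?_
    filter_upwards [ae_uIoc_of_ae_restrict hrhs ht] with τ hτ
    rw [hτ]
  refine ⟨⟨hV, ?_⟩, key⟩
  filter_upwards [hvB.1, ae_restrict_mem measurableSet_Ioc] with t h1 ht
  apply vecDist_injective γ
  rw [vecDist_negBessel_two, vecDist_freqRep h1, ← key t (Ioc_subset_Icc_self ht)]

/-- Pointwise `|ξ_i ξ_j| ≤ |ξ|²`, so each second derivative is controlled by the Laplacian. -/
theorem norm_hess_vop_le (i j : Fin d) (x : VecL2 d d₁) :
    ‖(hessSymbol i j).vop d₁ x‖ ≤ ‖(lapSymbol d).vop d₁ x‖ := by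
  refine BddSymbol.norm_vop_le (fun ξ ↦ ?_) x
  rw [abs_of_nonneg (lapSymbol_nonneg ξ)]
  simp only [hessSymbol, lapSymbol]
  rw [abs_mul, abs_neg, abs_mul, abs_of_pos (besselSymbol_pos _ ξ), abs_of_nonneg (sq_nonneg _),
    mul_pow (2 * Real.pi) ‖ξ‖]
  have := abs_mul_coord_le i j ξ
  have := (besselSymbol_pos (-2) ξ).le
  gcongr

end Solution

end

end

end ParabolicSystem

/-! ### The main theorem -/

theorem mainTheorem5 (d d₁ : ℕ) (hd : 0 < d) (γ δ : ℝ) (hδ : 0 < δ)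
    (K : Fin d → ℝ) (hK : ∀ j, 0 < K j) :
    ∃ c : ℝ, 0 < c ∧
      ∀ (T : ℝ) (_ : 0 < T) (a : ParabolicSystem.Coeff d d₁)
        (_ : ∀ i j k r, AEMeasurable (fun t ↦ a t i j k r) (volume.restrict (Ioc 0 T)))
        (_ : ∃ M : ℝ, ∀ t ∈ Ioc 0 T, ∀ i j, ParabolicSystem.matNorm (a t i j) ≤ M)
        (_ : ParabolicSystem.Elliptic δ T a)
        (_ : ∀ t ∈ Ioc 0 T, ∀ j, ParabolicSystem.matNorm (a t ⟨0, hd⟩ j) ≤ K j)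
        (f : ℝ → ParabolicSystem.VecDistribution d d₁) (_ : ParabolicSystem.MemBH γ T f)
        (u₀ : ParabolicSystem.VecDistribution d d₁) (_ : ParabolicSystem.MemH (γ + 1) u₀),
        ∃ u : ℝ → ParabolicSystem.VecDistribution d d₁,
          ParabolicSystem.IsSolution γ T a f u₀ u ∧
          (∀ v, ParabolicSystem.IsSolution γ T a f u₀ v → ∀ t ∈ Icc 0 T, v t = u t) ∧
          (∀ i j, ParabolicSystem.MemBH γ T (fun t ↦ ParabolicSystem.secondDeriv i j (u t))) ∧
          ParabolicSystem.bhNormHessian γ T u ≤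
            c * ParabolicSystem.bhNorm γ T f + c * ParabolicSystem.hNorm (γ + 1) u₀ ∧
          ParabolicSystem.bhNorm (γ + 2) T u ≤
            c * Real.exp (c * T) *
              (ParabolicSystem.bhNorm γ T f + ParabolicSystem.hNorm (γ + 1) u₀) := by
  open ParabolicSystem in
  have hδ' : 0 < δ⁻¹ := inv_pos.2 hδ
  -- `D²` dominates both `δ⁻¹` and `δ⁻¹ ^ 2`, the two coefficients in the estimate of second
  -- derivatives.
  set D := δ⁻¹ + 1 with hD
  have hD1 : 1 ≤ D := by linarith
  -- The term `d * D` serves the Hessian, whose `d²` entries are each bounded by `D (φ + m)`; `2 * D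
  -- + 4` leaves room for the full norm.
  refine ⟨d * D + 2 * D + 4, by positivity, fun T hT a hmeas hbdd hell _ f hf u₀ hu₀ ↦ ?_⟩
  set c : ℝ := d * D + 2 * D + 4 with hc
  have hdD : 0 ≤ (d : ℝ) * D := by positivity
  have ha : Admissible δ T a := ⟨hmeas, hbdd, hell⟩
  have hF := hf.memLp_freqRep
  have hFc : ∀ᵐ t ∂(volume.restrict (Ioc 0 T)),
      vecConj d d₁ (freqRep γ (f t)) = freqRep γ (f t) := hf.1.mono fun t h ↦ h.vecConj_freqRep
  obtain ⟨U, hU, hlap⟩ := ha.exists_isMild hδ hT hF (freqRep (γ + 1) u₀)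
  have hUc := hU.vecConj_ae ha hδ hT hF hFc hu₀.vecConj_freqRep
  have hu := hU.vecDist_eq (γ := γ)
  have hss : ∀ i j, ∀ᵐ t ∂(volume.restrict (Ioc 0 T)), secondDeriv i j (vecDist γ
      (trajectory a (fun t ↦ freqRep γ (f t)) (freqRep (γ + 1) u₀) U t)) =
      vecDist γ ((hessSymbol i j).vop d₁ (U t)) := by
    intro i j
    filter_upwards [hu] with t h
    rw [h, secondDeriv_vecDist]
  have htrace := hU.integral_trajectory_sq_le ha hδ hT hF
  have hsum := integral_norm_sq_le hU.1
  set I := ∫ τ in Ioc 0 T, ‖(lapSymbol d).vop d₁ (U τ)‖ ^ 2 with hI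
  have hΦ : ∫ τ in Ioc 0 T, ‖freqRep γ (f τ)‖ ^ 2 = bhNorm γ T f ^ 2 := by
    rw [bhNorm_eq, Real.sq_sqrt (integral_nonneg fun _ ↦ sq_nonneg _)]
  have hφ0 : 0 ≤ bhNorm γ T f := Real.sqrt_nonneg _
  have hm0 : 0 ≤ hNorm (γ + 1) u₀ := Real.sqrt_nonneg _
  rw [hΦ, ← hNorm_eq] at hlap htrace
  set φ := bhNorm γ T f
  set m := hNorm (γ + 1) u₀
  have hIle : I ≤ (D * (φ + m)) ^ 2 := by
    have h1 : δ⁻¹ * m ^ 2 ≤ D ^ 2 * m ^ 2 := by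
      gcongr
      nlinarith
    have h2 : δ⁻¹ ^ 2 * φ ^ 2 ≤ D ^ 2 * φ ^ 2 := by
      gcongr
      linarith
    have h3 : 0 ≤ D ^ 2 * (2 * (φ * m)) := by positivity
    nlinarith
  -- The solution is the trajectory read at level `γ`, not `U` read at level `γ+2`: the two agree
  -- only almost everywhere, whereas the initial condition and the weak equation concern every time.
  refine ⟨_, hU.isSolution ha hδ hT hu₀ hf, fun v hv t ht ↦ ?_, fun i j ↦ ?_, ?_, ?_⟩
  · obtain ⟨h1, h2⟩ := hv.isMild ha hu₀ hf
    rw [h2 t ht, h1.trajectory_unique ha hδ hT hF hU ht]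
  · refine memBH_of_freq (hU.1.continuousLinearMap_comp ((hessSymbol i j).vop d₁)) ?_ (hss i j)
    filter_upwards [hUc] with t h
    rw [vecConj_vop, h]
  · have h1 : ∀ i j, bhNorm γ T (fun t ↦ secondDeriv i j (vecDist γ
        (trajectory a (fun t ↦ freqRep γ (f t)) (freqRep (γ + 1) u₀) U t))) ^ 2 ≤
        (D * (φ + m)) ^ 2 := by
      intro i j
      rw [bhNorm_eq_of_freq (hss i j), Real.sq_sqrt (integral_nonneg fun _ ↦ sq_nonneg _)]
      refine le_trans ?_ hIle
      exact integral_mono (integrable_norm_sq (hU.1.continuousLinearMap_comp _))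
        (integrable_norm_sq (hU.1.continuousLinearMap_comp _))
        fun τ ↦ pow_le_pow_left₀ (norm_nonneg _) (norm_hess_vop_le i j _) 2
    have h2 : bhNormHessian γ T (fun t ↦ vecDist γ
        (trajectory a (fun t ↦ freqRep γ (f t)) (freqRep (γ + 1) u₀) U t)) ≤
        d * (D * (φ + m)) := by
      refine Real.sqrt_le_iff.2 ⟨by positivity, ?_⟩
      refine (Finset.sum_le_sum fun i _ ↦ Finset.sum_le_sum fun j _ ↦ h1 i j).trans (le_of_eq ?_)
      simp
      ring
    refine h2.trans ?_
    have h3 : 0 ≤ (2 * D + 4) * (φ + m) := by positivity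
    rw [hc]
    linarith
  · rw [bhNorm_eq_of_freq hu]
    have h1 : √(∫ τ in Ioc 0 T, ‖U τ‖ ^ 2) ≤ (2 * D + 2 + 4 * T) * (φ + m) := by
      refine Real.sqrt_le_iff.2 ⟨by positivity, hsum.trans ?_⟩
      have h2 : T * (2 * m ^ 2 + 4 * T * φ ^ 2) ≤ (2 * T + 4 * T ^ 2) * (φ + m) ^ 2 := by
        have e1 : 0 ≤ T * (φ * m) := by positivity
        have e2 : 0 ≤ T ^ 2 * (φ * m) := by positivity
        have e3 : 0 ≤ T * φ ^ 2 := by positivity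
        have e4 : 0 ≤ T ^ 2 * m ^ 2 := by positivity
        nlinarith
      have h3 : 2 * D ^ 2 + 2 * (2 * T + 4 * T ^ 2) ≤ (2 * D + 2 + 4 * T) ^ 2 := by
        have e1 : 0 ≤ D * T := by positivity
        nlinarith [sq_nonneg D, sq_nonneg T]
      have h4 := mul_le_mul_of_nonneg_right h3 (sq_nonneg (φ + m))
      nlinarith
    refine h1.trans ?_
    gcongr
    -- The linear growth `2 * D + 2 + 4 * T` is absorbed by `c (c T + 1) ≤ c e^{cT}`, using `4 ≤ c`.
    have hexp := Real.add_one_le_exp (c * T)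
    have hc4 : 4 ≤ c := by rw [hc]; nlinarith
    have h5 : c * (c * T + 1) ≤ c * Real.exp (c * T) := by gcongr
    have h6 : 4 * T ≤ c * (c * T) := by
      have : 0 ≤ c * T := by positivity
      nlinarith
    rw [hc] at *
    linarith
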